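/- Let $\mathcal M_+(0,1)$ be the set of Lebesgue measurable functions $f\colon(0,1)\to[0,\infty]$, let $f^*(t)=\inf\{\lambda\ge 0: |\{f>\lambda\}|\le t\}$ be the nonincreasing rearrangement of $f$, and let $I\colon(0,1)\to(0,1)$ be a quasiconcave function, meaning here that $I$ is a nondecreasing bijection with $I(0+)=0$ and $I(1-)=1$ for which $t\mapsto I(t)/t$ is nonincreasing. Suppose that there is a constant $K<\infty$ with $$\int_0^t\frac{I(s)}{s}\,ds\le K\,I(t),\qquad t\in(0,1).$$ Define, for $f\in\mathcal M_+(0,1)$ and $t\in(0,1)$, $$H_If(t)=\int_t^1\frac{f(s)}{I(s)}\,ds,\qquad S_If(t)=\frac1{I(t)}\sup_{0<s\le t}I(s)f^*(s).$$ Let $X$ be a rearrangement-invariant (r.i.) Banach function space over $(0,1)$ with Lebesgue measure, in the sense of Bennett and Sharpley (so $\|\cdot\|_X$ is a functional on all of $\mathcal M_+(0,1)$ with values in $[0,\infty]$, has the Fatou property, and satisfies $\|1\|_X<\infty$, $\|f\|_1\le c\|f\|_X$ and $\|f\|_X=\|f^*\|_X$), with associate norm $\|f\|_{X'}=\sup\{\int_0^1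 fg : g\in\mathcal M_+(0,1),\ \|g\|_X\le1\}$. An r.i. space $Y$ is called an optimal target space for $X$ under $H_I$ if $H_I\colon X\to Y$ is bounded and if $Y$ is continuously embedded in every r.i. space $Z$ for which $H_I\colon X\to Z$ is bounded. **Theorem.** An optimal target space $Y_X$ for $X$ under $H_I$ exists, and for every such space (it is unique up to equivalence of norms) there is a constant $C\in(0,\infty)$ such that, for every $f\in\mathcal M_+(0,1)$, $$C^{-1}\|f\|_{Y_X}\ \le\ \sup_{g\in\mathcal M_+(0,1),\ \|S_Ig\|_{X'}\le1}\ \int_0^1 -I(t)\,g^*(t)\,df^*(t)\;+\;\|f\|_{1}\ \le\ C\,\|f\|_{Y_X}.$$ Here $\|f\|_1=\int_0^1 f$, and the integral with respect to $-df^*$ is the Lebesgue–Stieltjes integral over the open interval $(0,1)$. -/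

import Mathlib

open MeasureTheory Set Filter Topology
open scoped ENNReal NNReal

namespace RISpace

/-- Lebesgue measure on the interval `(0, 1)`. -/
noncomputable abbrev vol01 : Measure ℝ := volume.restrict (Ioo 0 1)

/-- `MPlus f` says that `f` represents an element of `M₊(0, 1)`: it is nonnegative, possibly
infinite-valued, and Lebesgue measurable on `(0, 1)`. The values of `f` off `(0, 1)` are
irrelevant. -/
abbrev MPlus (f : ℝ → ℝ≥0∞) : Prop := AEMeasurable f vol01

/-- The nonincreasing rearrangement `f^*(t) = inf {l ≥ 0 : |{f > l}| ≤ t}`, for `t ≥ 0`. -/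
noncomputable def rearr (f : ℝ → ℝ≥0∞) (t : ℝ) : ℝ≥0∞ :=
  sInf {l : ℝ≥0∞ | vol01 {x | l < f x} ≤ ENNReal.ofReal t}

/-- Rearrangement-invariant Banach function norms on `M₊(0, 1)`. -/
structure IsRINorm (ρ : (ℝ → ℝ≥0∞) → ℝ≥0∞) : Prop where
  eq_zero_iff : ∀ f, MPlus f → (ρ f = 0 ↔ f =ᵐ[vol01] 0)
  smul : ∀ f, MPlus f → ∀ a : ℝ≥0, ρ (fun x => a * f x) = a * ρ f
  add_le : ∀ f g, MPlus f → MPlus g → ρ (fun x => f x + g x) ≤ ρ f + ρ g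
  mono : ∀ f g, MPlus f → MPlus g → (∀ᵐ x ∂vol01, f x ≤ g x) → ρ f ≤ ρ g
  fatou : ∀ (f : ℕ → ℝ → ℝ≥0∞) (g : ℝ → ℝ≥0∞), (∀ n, MPlus (f n)) → MPlus g →
    (∀ᵐ x ∂vol01, Monotone (fun n => f n x) ∧ Tendsto (fun n => f n x) atTop (𝓝 (g x))) →
    Tendsto (fun n => ρ (f n)) atTop (𝓝 (ρ g))
  one_lt_top : ρ (fun _ => 1) < ∞
  lintegral_le : ∃ C : ℝ≥0, ∀ f, MPlus f → ∫⁻ x in Ioo (0 : ℝ) 1, f x ≤ C * ρ f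
  rearr_eq : ∀ f, MPlus f → ρ (rearr f) = ρ f

/-- The associate functional `ρ'(f) = sup {∫₀¹ f g : g ∈ M₊(0, 1), ρ(g) ≤ 1}`. -/
noncomputable def assoc (ρ : (ℝ → ℝ≥0∞) → ℝ≥0∞) (f : ℝ → ℝ≥0∞) : ℝ≥0∞ :=
  ⨆ (g : ℝ → ℝ≥0∞) (_ : MPlus g) (_ : ρ g ≤ 1), ∫⁻ x in Ioo (0 : ℝ) 1, f x * g x

/-- `T : X → Y` is bounded, where `X` and `Y` are the spaces given by `ρ` and `σ`. -/
def Bounded (T : (ℝ → ℝ≥0∞) → ℝ → ℝ≥0∞) (ρ σ : (ℝ → ℝ≥0∞) → ℝ≥0∞) : Prop :=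
  ∃ C : ℝ≥0, ∀ f, MPlus f → ρ f < ∞ → σ (T f) ≤ C * ρ f

/-- The r.i. space given by `σ` is an optimal (that is, smallest) r.i. target space for the space
given by `ρ` under the mapping `T`. -/
structure IsOptimalTarget (T : (ℝ → ℝ≥0∞) → ℝ → ℝ≥0∞) (ρ σ : (ℝ → ℝ≥0∞) → ℝ≥0∞) : Prop where
  isRINorm : IsRINorm σ
  bounded : Bounded T ρ σ
  optimal : ∀ τ, IsRINorm τ → Bounded T ρ τ → Bounded (fun f => f) σ τ

/-- Quasiconcave functions `I : (0, 1) → (0, 1)`, normalized to be bijections with `I(0+) = 0` and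
`I(1-) = 1`. Only the values of `I` on `(0, 1)` matter. -/
structure IsQuasiconcave (I : ℝ → ℝ) : Prop where
  bijOn : BijOn I (Ioo 0 1) (Ioo 0 1)
  monotoneOn : MonotoneOn I (Ioo 0 1)
  antitoneOn : AntitoneOn (fun t => I t / t) (Ioo 0 1)
  tendsto_zero : Tendsto I (𝓝[>] 0) (𝓝 0)
  tendsto_one : Tendsto I (𝓝[<] 1) (𝓝 1)

/-- The operator `H_I f(t) = ∫ₜ¹ f(s) / I(s) ds`, for `0 < t < 1`. -/
noncomputable def opH (I : ℝ → ℝ) (f : ℝ → ℝ≥0∞) (t : ℝ) : ℝ≥0∞ :=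
  ∫⁻ s in Ioo t 1, f s / ENNReal.ofReal (I s)

/-- The operator `S_I f(t) = (1 / I(t)) sup_{0 < s ≤ t} I(s) f^*(s)`, for `0 < t < 1`. -/
noncomputable def opS (I : ℝ → ℝ) (f : ℝ → ℝ≥0∞) (t : ℝ) : ℝ≥0∞ :=
  (⨆ s ∈ Ioc 0 t, ENNReal.ofReal (I s) * rearr f s) / ENNReal.ofReal (I t)

theorem rearr_antitone (f : ℝ → ℝ≥0∞) : Antitone (rearr f) := fun _ _ h =>
  sInf_le_sInf fun _ hl => le_trans hl (ENNReal.ofReal_le_ofReal h)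

theorem rearr_rightContinuous (f : ℝ → ℝ≥0∞) (t : ℝ) :
    ContinuousWithinAt (rearr f) (Ici t) t := by
  refine tendsto_order.2 ⟨fun L hL => ?_, fun U hU => ?_⟩
  · obtain ⟨M, hLM, hM⟩ := exists_between hL
    have hd : ENNReal.ofReal t < vol01 {x | M < f x} := by
      by_contra h
      exact absurd (sInf_le (show M ∈ {l | vol01 {x | l < f x} ≤ ENNReal.ofReal t} from not_lt.1 h))
        (not_le.2 hM)
    have hev : ∀ᶠ u in 𝓝 t, ENNReal.ofReal u < vol01 {x | M < f x} :=
      ENNReal.continuous_ofReal.continuousAt.eventually_lt continuousAt_const hd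
    filter_upwards [nhdsWithin_le_nhds hev] with u hu
    refine lt_of_lt_of_le hLM (le_sInf fun l hl => ?_)
    by_contra hlM
    have hsub : {x | M < f x} ⊆ {x | l < f x} := fun x hx => lt_trans (not_le.1 hlM) hx
    exact absurd (le_trans (measure_mono hsub) hl) (not_le.2 hu)
  · filter_upwards [self_mem_nhdsWithin] with u hu
    exact lt_of_le_of_lt (rearr_antitone f hu) hU

/-- The nondecreasing right-continuous function `-min (f^*, n)`. -/
noncomputable def negTrunc (f : ℝ → ℝ≥0∞) (n : ℕ) : StieltjesFunction ℝ where
  toFun t := -(min (rearr f t) n).toReal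
  mono' a b h := by
    refine neg_le_neg (ENNReal.toReal_mono ?_ (min_le_min_right _ (rearr_antitone f h)))
    exact ne_top_of_le_ne_top (ENNReal.natCast_ne_top n) (min_le_right _ _)
  right_continuous' t := by
    have hne : min (rearr f t) (n : ℝ≥0∞) ≠ ∞ :=
      ne_top_of_le_ne_top (ENNReal.natCast_ne_top n) (min_le_right _ _)
    have hmin : Tendsto (fun u => min (rearr f u) (n : ℝ≥0∞)) (𝓝[≥] t)
        (𝓝 (min (rearr f t) (n : ℝ≥0∞))) :=
      Tendsto.min (rearr_rightContinuous f t) tendsto_const_nhds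
    exact ((ENNReal.tendsto_toReal hne).comp hmin).neg

/-- The Lebesgue–Stieltjes integral `∫₀¹ -φ(t) df^*(t)` over the open interval `(0, 1)`, for
`φ ≥ 0`. Since `f^*` may be unbounded near `0`, it is the (increasing) limit of the integrals with
respect to the Lebesgue–Stieltjes measures of the bounded functions `-min (f^*, n)`. -/
noncomputable def stieltjesInt (φ : ℝ → ℝ≥0∞) (f : ℝ → ℝ≥0∞) : ℝ≥0∞ :=
  ⨆ n : ℕ, ∫⁻ t in Ioo (0 : ℝ) 1, φ t ∂(negTrunc f n).measure

/-- `sup {∫₀¹ -I(t) g^*(t) df^*(t) : g ∈ M₊(0, 1), ‖S_I g‖_{X'} ≤ 1} + ‖f‖₁`, where `X` is the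
space given by `ρ`. -/
noncomputable def explicitNorm (I : ℝ → ℝ) (ρ : (ℝ → ℝ≥0∞) → ℝ≥0∞) (f : ℝ → ℝ≥0∞) : ℝ≥0∞ :=
  (⨆ (g : ℝ → ℝ≥0∞) (_ : MPlus g) (_ : assoc ρ (opS I g) ≤ 1),
    stieltjesInt (fun t => ENNReal.ofReal (I t) * rearr g t) f) + ∫⁻ x in Ioo (0 : ℝ) 1, f x

end RISpace

/-!
On nonincreasing functions, `R_I h(t) = (1 / I(t)) ∫₀ᵗ h^*` is dual to `H_I`. Hence the associate
norm of the optimal target space is equivalent to `h ↦ ‖R_I h‖_{X'}`, and the optimal norm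
itself is `optNorm I ρ f = sup {∫₀¹ f^* h^* : ‖R_I h‖_{X'} ≤ 1}`. Its triangle inequality is
Hardy's lemma (`lintegral_mul_rearr_mono`) together with the subadditivity of `f ↦ ∫₀ᵗ f^*`
(`setLIntegral_rearr_add_le`), which follows from `∫₀ᵗ f^* = min_c (c t + ∫ (f - c)₊)`. Boundedness
of `H_I` is the duality formula. For optimality, a competing target norm `τ` is written as its second
associate (`le_assoc_assoc`, by separation in `L²`), and its associate norm dominates `‖R_I ·‖_{X'}`
because it does not increase under rearrangement (`assoc_rearr_le`). The latter holds since, Lebesgue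
measure having no atoms, equality is attained in the Hardy–Littlewood inequality
(`exists_equimeasurable_lintegral_eq`).

It remains to compare `optNorm` with the explicit norm. Write `ν` for the Stieltjes measure of
`-f^*`, so that `f^*(t)` is `ν((t, 1))` up to the essential infimum of `f`, which is at most `‖f‖₁`.
By Tonelli, `∫ f^* h^*` is `∫ (∫₀ᵗ h^*) dν(t)` up to a multiple of `‖f‖₁`.

* Given `g` with `‖S_I g‖_{X'} ≤ 1`, the function `G = I · S_I g` is a quasiconcave majorant of
  `I g^*`. After truncating `g` it vanishes at `0`, and `h(s) = (G(s) - G(s/2)) / s` satisfies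
  `G(t) ≤ 2 ∫₀ᵗ h` and `∫₀ᵗ h^* ≤ 2 G(t)` (`exists_density_of_quasiconcave`). So `‖R_I h‖_{X'} ≤ 2`,
  and `∫ I g^* dν` is at most a multiple of `∫ f^* h^*`.
* Given `h` with `‖R_I h‖_{X'} ≤ 1`, let `U` be the least nonincreasing majorant of `R_I h`. Then
  `S_I U ≤ U` and `I U ≥ ∫₀ᵗ h^*`. A value of `R_I h` at `r` is attained up to the factor `2` on all
  of `(r/2, r)`, so `U(t) ≤ 2 (R_I h)^*(t/4)`, and boundedness of dilations gives `‖U‖_{X'} ≤ 8`.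
-/

namespace RISpace

/-! ### Rearrangements, the Hardy–Littlewood inequality and Hardy's lemma -/

theorem lt_rearr_iff {f : ℝ → ℝ≥0∞} {t : ℝ} {l : ℝ≥0∞} :
    l < rearr f t ↔ ENNReal.ofReal t < vol01 {x | l < f x} := by
  constructor
  · intro h
    by_contra h'
    exact absurd (sInf_le (show l ∈ {l | vol01 {x | l < f x} ≤ ENNReal.ofReal t} from not_lt.1 h'))
      (not_le.2 h)
  · intro h
    rcases eq_or_ne l ∞ with rfl | hl
    · simp at h
    obtain ⟨u, hu, hul, hlim⟩ := exists_seq_strictAnti_tendsto' (lt_top_iff_ne_top.2 hl)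
    have hset : {x | l < f x} = ⋃ n, {x | u n < f x} := by
      ext x
      simp only [mem_ofPred_eq, mem_iUnion]
      constructor
      · intro hx
        exact ((hlim.eventually_lt tendsto_const_nhds hx).exists)
      · rintro ⟨n, hn⟩
        exact (hul n).1.trans hn
    have hm : Monotone fun n => {x | u n < f x} := fun m n hmn x hx =>
      lt_of_le_of_lt (hu.antitone hmn) hx
    rw [hset, hm.measure_iUnion] at h
    obtain ⟨n, hn⟩ := lt_iSup_iff.1 h
    refine (hul n).1.trans_le (le_sInf fun k hk => ?_)
    by_contra hlt
    have hsub : {x | u n < f x} ⊆ {x | k < f x} := fun x hx => lt_trans (not_le.1 hlt) hx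
    exact absurd ((measure_mono hsub).trans hk) (not_le.2 hn)

theorem rearr_le_iff {f : ℝ → ℝ≥0∞} {t : ℝ} {l : ℝ≥0∞} :
    rearr f t ≤ l ↔ vol01 {x | l < f x} ≤ ENNReal.ofReal t := by
  rw [← not_lt, lt_rearr_iff, not_lt]

theorem vol01_le_one (s : Set ℝ) : vol01 s ≤ 1 := by
  refine (measure_mono (subset_univ s)).trans ?_
  simp

instance : IsProbabilityMeasure vol01 := ⟨by simp⟩

theorem vol01_lt_rearr (f : ℝ → ℝ≥0∞) (l : ℝ≥0∞) :
    {t | l < rearr f t} ∩ Ioo 0 1 = Ioo 0 (vol01 {x | l < f x}).toReal := by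
  have hfin : vol01 {x | l < f x} ≠ ∞ := measure_ne_top _ _
  have h1 : (vol01 {x | l < f x}).toReal ≤ 1 :=
    ENNReal.toReal_le_of_le_ofReal zero_le_one (by simpa using vol01_le_one _)
  ext t
  simp only [mem_inter_iff, mem_ofPred_eq, lt_rearr_iff, mem_Ioo]
  constructor
  · rintro ⟨h, h0, -⟩
    exact ⟨h0, (ENNReal.ofReal_lt_iff_lt_toReal h0.le hfin).1 h⟩
  · rintro ⟨h0, h⟩
    exact ⟨(ENNReal.ofReal_lt_iff_lt_toReal h0.le hfin).2 h, h0, h.trans_le h1⟩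

/-- A function and its rearrangement are equimeasurable. -/
theorem measure_lt_rearr (f : ℝ → ℝ≥0∞) (l : ℝ≥0∞) :
    vol01 {t | l < rearr f t} = vol01 {x | l < f x} := by
  rw [Measure.restrict_apply' measurableSet_Ioo, vol01_lt_rearr, Real.volume_Ioo, sub_zero,
    ENNReal.ofReal_toReal (measure_ne_top _ _)]

theorem rearr_congr {f g : ℝ → ℝ≥0∞}
    (h : ∀ l, vol01 {x | l < f x} = vol01 {x | l < g x}) : rearr f = rearr g := by
  ext t
  simp only [rearr, h]

theorem rearr_rearr (f : ℝ → ℝ≥0∞) : rearr (rearr f) = rearr f :=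
  rearr_congr (measure_lt_rearr f)

theorem rearr_mono {f g : ℝ → ℝ≥0∞} (h : ∀ᵐ x ∂vol01, f x ≤ g x) (t : ℝ) :
    rearr f t ≤ rearr g t := by
  refine le_sInf fun l hl => sInf_le (le_trans (measure_mono_ae ?_) hl)
  filter_upwards [h] with x hx hlx
  exact lt_of_lt_of_le hlx hx

theorem rearr_congr_ae {f g : ℝ → ℝ≥0∞} (h : f =ᵐ[vol01] g) : rearr f = rearr g :=
  funext fun t => le_antisymm (rearr_mono h.le t) (rearr_mono h.symm.le t)

theorem measurable_rearr (f : ℝ → ℝ≥0∞) : Measurable (rearr f) := (rearr_antitone f).measurable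

theorem mplus_rearr (f : ℝ → ℝ≥0∞) : MPlus (rearr f) := (measurable_rearr f).aemeasurable

theorem rearr_smul (f : ℝ → ℝ≥0∞) {a : ℝ≥0} (ha : a ≠ 0) (t : ℝ) :
    rearr (fun x => a * f x) t = a * rearr f t := by
  refine eq_of_forall_lt_iff fun l => ?_
  have ha' : (a : ℝ≥0∞) ≠ 0 := by simpa using ha
  have key : ∀ y : ℝ≥0∞, l < a * y ↔ l / a < y := fun y => by
    rw [ENNReal.div_lt_iff (Or.inl ha') (Or.inl ENNReal.coe_ne_top), mul_comm]
  simp only [lt_rearr_iff, key]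

theorem rearr_iSup {f : ℕ → ℝ → ℝ≥0∞} {g : ℝ → ℝ≥0∞}
    (h : ∀ᵐ x ∂vol01, Monotone (fun n => f n x) ∧ Tendsto (fun n => f n x) atTop (𝓝 (g x)))
    (t : ℝ) : rearr g t = ⨆ n, rearr (f n) t := by
  have hg : rearr g = rearr (fun x => ⨆ n, f n x) := by
    refine rearr_congr_ae ?_
    filter_upwards [h] with x hx
    exact tendsto_nhds_unique hx.2 (tendsto_atTop_iSup hx.1)
  refine le_antisymm ?_ (iSup_le fun n => rearr_mono ?_ t)
  · refine le_of_forall_lt fun l hl => ?_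
    rw [hg, lt_rearr_iff] at hl
    have hset : {x | l < ⨆ n, f n x} = ⋃ n, {x | l < f n x} := by
      ext x; simp [lt_iSup_iff]
    -- Monotonicity holds only almost everywhere, so the sets are compared with partial unions.
    have hm : Monotone fun n => ⋃ k ≤ n, {x | l < f k x} := fun m n hmn =>
      biUnion_subset_biUnion_left fun k hk => le_trans hk hmn
    have hset' : {x | l < ⨆ n, f n x} = ⋃ n, ⋃ k ≤ n, {x | l < f k x} := by
      rw [hset]
      ext x
      simp only [mem_iUnion, mem_ofPred_eq, exists_prop]
      exact ⟨fun ⟨n, hn⟩ => ⟨n, n, le_rfl, hn⟩, fun ⟨_, k, _, hk⟩ => ⟨k, hk⟩⟩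
    rw [hset', hm.measure_iUnion] at hl
    obtain ⟨n, hn⟩ := lt_iSup_iff.1 hl
    refine lt_of_lt_of_le (lt_rearr_iff.2 (hn.trans_le (measure_mono_ae ?_)))
      (le_iSup (fun n => rearr (f n) t) n)
    filter_upwards [h] with x hx hxm
    obtain ⟨k, hk, hlk⟩ := mem_iUnion₂.1 (show x ∈ ⋃ k ≤ n, {x | l < f k x} from hxm)
    exact lt_of_lt_of_le hlk (hx.1 hk)
  · filter_upwards [h] with x hx
    exact hx.1.ge_of_tendsto hx.2 n

theorem rearr_le_of_antitoneOn {u : ℝ → ℝ≥0∞} (hu : AntitoneOn u (Ioo 0 1)) {t : ℝ}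
    (ht : t ∈ Ioo (0 : ℝ) 1) : rearr u t ≤ u t := by
  rw [rearr_le_iff, Measure.restrict_apply' measurableSet_Ioo]
  have hsub : {x | u t < u x} ∩ Ioo 0 1 ⊆ Ioo 0 t := by
    rintro x ⟨hx, hx1⟩
    refine ⟨hx1.1, ?_⟩
    by_contra hlt
    exact absurd (hu ht hx1 (not_lt.1 hlt)) (not_le.2 hx)
  refine (measure_mono hsub).trans ?_
  simp

theorem lt_measure_of_subset {A : Set ℝ} {s t : ℝ} (ht : 0 ≤ t) (hts : t < s)
    {c : ℝ} (hsub : Ioo c (c + s) ⊆ A ∩ Ioo 0 1) : ENNReal.ofReal t < vol01 A := by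
  rw [Measure.restrict_apply' measurableSet_Ioo]
  refine lt_of_lt_of_le ?_ (measure_mono hsub)
  rw [Real.volume_Ioo, add_sub_cancel_left]
  exact (ENNReal.ofReal_lt_ofReal_iff (ht.trans_lt hts)).2 hts

theorem le_rearr_of_antitoneOn {u : ℝ → ℝ≥0∞} (hu : AntitoneOn u (Ioo 0 1)) {s t : ℝ}
    (ht : 0 ≤ t) (hts : t < s) (hs : s < 1) : u s ≤ rearr u t := by
  refine le_of_forall_lt fun l hl => ?_
  rw [lt_rearr_iff]
  refine lt_measure_of_subset (c := 0) ht hts fun x hx => ?_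
  rw [zero_add] at hx
  have hx1 : x ∈ Ioo (0 : ℝ) 1 := ⟨hx.1, hx.2.trans hs⟩
  exact ⟨lt_of_lt_of_le hl (hu hx1 ⟨ht.trans_lt hts, hs⟩ hx.2.le), hx1⟩

theorem volume_setOf_ofReal_lt (y : ℝ≥0∞) :
    volume ({a : ℝ | ENNReal.ofReal a < y} ∩ Ioi 0) = y := by
  rcases eq_or_ne y ∞ with rfl | hy
  · simp
  have : {a : ℝ | ENNReal.ofReal a < y} ∩ Ioi 0 = Ioo 0 y.toReal := by
    ext a
    simp only [mem_inter_iff, mem_ofPred_eq, mem_Ioi, mem_Ioo]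
    constructor
    · rintro ⟨h, h0⟩
      exact ⟨h0, (ENNReal.ofReal_lt_iff_lt_toReal h0.le hy).1 h⟩
    · rintro ⟨h0, h⟩
      exact ⟨(ENNReal.ofReal_lt_iff_lt_toReal h0.le hy).2 h, h0⟩
  rw [this, Real.volume_Ioo, sub_zero, ENNReal.ofReal_toReal hy]

/-- The layer cake formula for `[0, ∞]`-valued functions. -/
theorem lintegral_eq_lintegral_measure_lt {ν : Measure ℝ} [SFinite ν] {f : ℝ → ℝ≥0∞}
    (hf : Measurable f) :
    ∫⁻ x, f x ∂ν = ∫⁻ a in Ioi (0 : ℝ), ν {x | ENNReal.ofReal a < f x} := by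
  have hmeas : MeasurableSet {p : ℝ × ℝ | ENNReal.ofReal p.2 < f p.1} :=
    measurableSet_lt (by fun_prop) (by fun_prop)
  have h1 : ∀ x, f x = ∫⁻ a in Ioi (0 : ℝ),
      {p : ℝ × ℝ | ENNReal.ofReal p.2 < f p.1}.indicator (fun _ => 1) (x, a) := fun x => by
    have : (fun a => {p : ℝ × ℝ | ENNReal.ofReal p.2 < f p.1}.indicator
        (fun _ => (1 : ℝ≥0∞)) (x, a)) = {a : ℝ | ENNReal.ofReal a < f x}.indicator 1 := by
      ext a; simp [indicator]
    rw [this, lintegral_indicator_one (measurableSet_lt (by fun_prop) (by fun_prop)),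
      Measure.restrict_apply' measurableSet_Ioi, volume_setOf_ofReal_lt]
  conv_lhs => enter [2, x]; rw [h1 x]
  rw [lintegral_lintegral_swap]
  · refine lintegral_congr fun a => ?_
    have : (fun x => {p : ℝ × ℝ | ENNReal.ofReal p.2 < f p.1}.indicator
        (fun _ => (1 : ℝ≥0∞)) (x, a)) = {x | ENNReal.ofReal a < f x}.indicator 1 := by
      ext a; simp [indicator]
    rw [this, lintegral_indicator_one (measurableSet_lt (by fun_prop) (by fun_prop))]
  · exact (measurable_const.indicator hmeas).aemeasurable

theorem lintegral_mul_eq_lintegral_setLIntegral {f g : ℝ → ℝ≥0∞} (hf : MPlus f)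
    (hg : Measurable g) :
    ∫⁻ x in Ioo (0 : ℝ) 1, f x * g x =
      ∫⁻ a in Ioi (0 : ℝ), ∫⁻ x in {x | ENNReal.ofReal a < g x}, f x ∂vol01 := by
  have h := lintegral_withDensity_eq_lintegral_mul₀ hf hg.aemeasurable
  simp only [Pi.mul_apply] at h
  rw [← h, lintegral_eq_lintegral_measure_lt hg]
  refine lintegral_congr fun a => ?_
  rw [withDensity_apply _ (measurableSet_lt measurable_const hg)]

theorem lintegral_mul_eq_lintegral_measure_inter {f g : ℝ → ℝ≥0∞} (hf : Measurable f)
    (hg : Measurable g) :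
    ∫⁻ x in Ioo (0 : ℝ) 1, f x * g x = ∫⁻ a in Ioi (0 : ℝ), ∫⁻ b in Ioi (0 : ℝ),
      vol01 ({x | ENNReal.ofReal b < f x} ∩ {x | ENNReal.ofReal a < g x}) := by
  rw [lintegral_mul_eq_lintegral_setLIntegral hf.aemeasurable hg]
  refine lintegral_congr fun a => ?_
  rw [lintegral_eq_lintegral_measure_lt hf]
  refine lintegral_congr fun b => ?_
  rw [Measure.restrict_apply (measurableSet_lt measurable_const hf)]

theorem measure_inter_lt_rearr (f g : ℝ → ℝ≥0∞) (a b : ℝ≥0∞) :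
    vol01 ({x | a < rearr f x} ∩ {x | b < rearr g x}) =
      min (vol01 {x | a < f x}) (vol01 {x | b < g x}) := by
  have hs : ({x | a < rearr f x} ∩ {x | b < rearr g x}) ∩ Ioo 0 1 =
      Ioo 0 (min (vol01 {x | a < f x}).toReal (vol01 {x | b < g x}).toReal) := by
    rw [inter_inter_distrib_right, vol01_lt_rearr, vol01_lt_rearr, Ioo_inter_Ioo, max_self]
  rw [Measure.restrict_apply' measurableSet_Ioo, hs, Real.volume_Ioo, sub_zero,
    ← ENNReal.toReal_min (measure_ne_top _ _) (measure_ne_top _ _),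
    ENNReal.ofReal_toReal (ne_top_of_le_ne_top (measure_ne_top _ _) (min_le_left _ _))]

/-- The Hardy–Littlewood inequality. -/
theorem lintegral_mul_le_rearr {f g : ℝ → ℝ≥0∞} (hf : MPlus f) (hg : MPlus g) :
    ∫⁻ x in Ioo (0 : ℝ) 1, f x * g x ≤ ∫⁻ x in Ioo (0 : ℝ) 1, rearr f x * rearr g x := by
  have h : ∫⁻ x in Ioo (0 : ℝ) 1, f x * g x = ∫⁻ x in Ioo (0 : ℝ) 1, hf.mk f x * hg.mk g x := by
    refine lintegral_congr_ae ?_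
    filter_upwards [hf.ae_eq_mk, hg.ae_eq_mk] with x h1 h2
    rw [← h1, ← h2]
  rw [h, rearr_congr_ae hf.ae_eq_mk, rearr_congr_ae hg.ae_eq_mk,
    lintegral_mul_eq_lintegral_measure_inter hf.measurable_mk hg.measurable_mk,
    lintegral_mul_eq_lintegral_measure_inter (measurable_rearr _) (measurable_rearr _)]
  refine lintegral_mono fun a => lintegral_mono fun b => ?_
  simp only [measure_inter_lt_rearr]
  exact le_min (measure_mono inter_subset_left) (measure_mono inter_subset_right)

theorem lintegral_tsub_rearr {f : ℝ → ℝ≥0∞} (hf : MPlus f) (c : ℝ≥0∞) :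
    ∫⁻ x in Ioo (0 : ℝ) 1, (rearr f x - c) = ∫⁻ x in Ioo (0 : ℝ) 1, (f x - c) := by
  have h : ∫⁻ x in Ioo (0 : ℝ) 1, (f x - c) = ∫⁻ x in Ioo (0 : ℝ) 1, (hf.mk f x - c) := by
    refine lintegral_congr_ae ?_
    filter_upwards [hf.ae_eq_mk] with x h1
    rw [← h1]
  rw [h, rearr_congr_ae hf.ae_eq_mk,
    lintegral_eq_lintegral_measure_lt ((measurable_rearr _).sub_const c),
    lintegral_eq_lintegral_measure_lt (hf.measurable_mk.sub_const c)]
  refine lintegral_congr fun a => ?_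
  simp only [lt_tsub_iff_right]
  exact measure_lt_rearr _ _

theorem lintegral_rearr {f : ℝ → ℝ≥0∞} (hf : MPlus f) :
    ∫⁻ x in Ioo (0 : ℝ) 1, rearr f x = ∫⁻ x in Ioo (0 : ℝ) 1, f x := by
  simpa using lintegral_tsub_rearr hf 0

/-- Together with `setLIntegral_rearr_eq`, this exhibits `∫₀ᵗ f^*` as the minimum over `c` of
`c t + ∫ (f - c)₊`. -/
theorem setLIntegral_rearr_le {f : ℝ → ℝ≥0∞} (hf : MPlus f) {t : ℝ} (ht : t ≤ 1) (c : ℝ≥0∞) :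
    ∫⁻ x in Ioo 0 t, rearr f x ≤ c * ENNReal.ofReal t + ∫⁻ x in Ioo (0 : ℝ) 1, (f x - c) := by
  rw [← lintegral_tsub_rearr hf]
  calc ∫⁻ x in Ioo 0 t, rearr f x ≤ ∫⁻ x in Ioo 0 t, (c + (rearr f x - c)) :=
        lintegral_mono fun x => le_add_tsub
    _ = c * ENNReal.ofReal t + ∫⁻ x in Ioo 0 t, (rearr f x - c) := by
        rw [lintegral_add_left measurable_const, setLIntegral_const, Real.volume_Ioo, sub_zero]
    _ ≤ _ := by
        gcongr

theorem setLIntegral_rearr_eq {f : ℝ → ℝ≥0∞} (hf : MPlus f) {t : ℝ} (ht : t ∈ Ioo (0 : ℝ) 1) :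
    ∫⁻ x in Ioo 0 t, rearr f x = rearr f t * ENNReal.ofReal t
      + ∫⁻ x in Ioo (0 : ℝ) 1, (f x - rearr f t) := by
  rw [← lintegral_tsub_rearr hf]
  have h1 : ∫⁻ x in Ioo (0 : ℝ) 1, (rearr f x - rearr f t)
      = ∫⁻ x in Ioo 0 t, (rearr f x - rearr f t) := by
    refine le_antisymm ?_ (lintegral_mono_set (Ioo_subset_Ioo_right ht.2.le))
    rw [← lintegral_indicator measurableSet_Ioo, ← lintegral_indicator measurableSet_Ioo]
    refine lintegral_mono fun x => ?_
    by_cases hx : x ∈ Ioo (0 : ℝ) 1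
    · by_cases hxt : x < t
      · simp [indicator, hx.1, hx.2, hxt]
      · have : rearr f x - rearr f t = 0 :=
          tsub_eq_zero_of_le (rearr_antitone f (not_lt.1 hxt))
        simp [indicator, hx.1, hx.2, hxt, this]
    · rw [indicator_of_notMem hx]; exact zero_le
  rw [h1, ← sub_zero t, ← Real.volume_Ioo, ← setLIntegral_const, sub_zero,
    ← lintegral_add_left measurable_const]
  refine setLIntegral_congr_fun measurableSet_Ioo fun x hx => ?_
  exact (add_tsub_cancel_of_le (rearr_antitone f hx.2.le)).symm

/-- Subadditivity of `f ↦ ∫₀ᵗ f^*`: the sum of minimizers for `f` and `g` is a competitor for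
`f + g`. -/
theorem setLIntegral_rearr_add_le {f g : ℝ → ℝ≥0∞} (hf : MPlus f) (hg : MPlus g) {t : ℝ}
    (ht : t ∈ Ioc (0 : ℝ) 1) :
    ∫⁻ x in Ioo 0 t, rearr (fun x => f x + g x) x ≤
      ∫⁻ x in Ioo 0 t, (rearr f x + rearr g x) := by
  have hfg : MPlus fun x => f x + g x := hf.add hg
  rw [lintegral_add_left (measurable_rearr f)]
  rcases ht.2.lt_or_eq with h1 | rfl
  · have ht' : t ∈ Ioo (0 : ℝ) 1 := ⟨ht.1, h1⟩
    rw [setLIntegral_rearr_eq hf ht', setLIntegral_rearr_eq hg ht']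
    refine (setLIntegral_rearr_le hfg ht.2 (rearr f t + rearr g t)).trans ?_
    rw [add_mul, add_add_add_comm]
    gcongr
    rw [← lintegral_add_left' (hf.sub_const _)]
    exact lintegral_mono fun x => add_tsub_add_le_tsub_add_tsub
  · rw [lintegral_rearr hf, lintegral_rearr hg, lintegral_rearr hfg, lintegral_add_left' hf]

/-- Hardy's lemma: an inequality between the integrals over all intervals `(0, t)` is inherited
by the integrals against a nonincreasing weight. -/
theorem lintegral_mul_rearr_mono {F G : ℝ → ℝ≥0∞} (hF : MPlus F) (hG : MPlus G)
    (h : ∀ t ∈ Ioc (0 : ℝ) 1, ∫⁻ x in Ioo 0 t, F x ≤ ∫⁻ x in Ioo 0 t, G x) (w : ℝ → ℝ≥0∞) :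
    ∫⁻ x in Ioo (0 : ℝ) 1, F x * rearr w x ≤ ∫⁻ x in Ioo (0 : ℝ) 1, G x * rearr w x := by
  rw [lintegral_mul_eq_lintegral_setLIntegral hF (measurable_rearr w),
    lintegral_mul_eq_lintegral_setLIntegral hG (measurable_rearr w)]
  refine lintegral_mono fun a => ?_
  simp only [Measure.restrict_restrict (measurableSet_lt measurable_const (measurable_rearr w)),
    vol01_lt_rearr]
  rcases (ENNReal.toReal_nonneg (a := vol01 {x | ENNReal.ofReal a < w x})).eq_or_lt with h0 | h0
  · rw [← h0]; simp
  · exact h _ ⟨h0, ENNReal.toReal_le_of_le_ofReal zero_le_one (by simpa using vol01_le_one _)⟩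

/-! ### Resonance and the associate functional -/

theorem exists_superlevel_measure_eq {f : ℝ → ℝ≥0∞} (hf : Measurable f) {t : ℝ}
    (ht : t ∈ Ioo (0 : ℝ) 1) :
    ∃ c : ℝ, vol01 ({x | rearr f t < f x} ∪ {x | f x = rearr f t} ∩ Iic c)
      = ENNReal.ofReal t := by
  set l := rearr f t with hl
  have hfin : ∀ s : Set ℝ, vol01 s ≠ ∞ := fun s => measure_ne_top _ _
  set E : ℝ → Set ℝ := fun c => {x | l < f x} ∪ {x | f x = l} ∩ Iic c with hE
  have hcont : Continuous fun c => (vol01 (E c)).toReal := by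
    refine (LipschitzWith.of_le_add fun c d => ?_).continuous
    have hsub : E c ⊆ E d ∪ Ioc d c := by
      rintro x (hx | ⟨hx, hxc⟩)
      · exact Or.inl (Or.inl hx)
      · rcases le_or_gt x d with h | h
        · exact Or.inl (Or.inr ⟨hx, h⟩)
        · exact Or.inr ⟨h, hxc⟩
    have h1 : vol01 (E c) ≤ vol01 (E d) + ENNReal.ofReal (dist c d) := by
      refine (measure_mono hsub).trans ((measure_union_le _ _).trans ?_)
      gcongr
      refine (Measure.restrict_apply_le _ _).trans ?_
      rw [Real.volume_Ioc]
      exact ENNReal.ofReal_le_ofReal (le_abs_self _)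
    have h2 := ENNReal.toReal_mono (by finiteness [hfin (E d)]) h1
    rwa [ENNReal.toReal_add (hfin _) ENNReal.ofReal_ne_top, ENNReal.toReal_ofReal dist_nonneg]
      at h2
  have h0 : (vol01 (E 0)).toReal ≤ t := by
    refine ENNReal.toReal_le_of_le_ofReal ht.1.le ((measure_mono_ae ?_).trans
      (rearr_le_iff.1 hl.ge))
    filter_upwards [ae_restrict_mem measurableSet_Ioo] with x hx hxE
    rcases (show x ∈ E 0 from hxE) with h | h
    · exact h
    · exact absurd h.2 (not_le.2 hx.1)
  have h1 : t ≤ (vol01 (E 1)).toReal := by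
    rw [← ENNReal.ofReal_le_iff_le_toReal (hfin _)]
    have hle : vol01 {x | l ≤ f x} ≤ vol01 (E 1) := by
      refine measure_mono_ae ?_
      filter_upwards [ae_restrict_mem measurableSet_Ioo] with x hx hxE
      rcases (show l ≤ f x from hxE).lt_or_eq with h | h
      · exact Or.inl h
      · exact Or.inr ⟨h.symm, hx.2.le⟩
    refine le_trans ?_ hle
    rcases eq_or_ne l 0 with h | h
    · simpa [h] using ht.2.le
    obtain ⟨u, hu, hul, hlim⟩ := exists_seq_strictMono_tendsto' (pos_iff_ne_zero.2 h)
    have hset : {x | l ≤ f x} = ⋂ n, {x | u n < f x} := by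
      ext x
      simp only [mem_ofPred_eq, mem_iInter]
      exact ⟨fun hx n => (hul n).2.trans_le hx, fun hx => le_of_tendsto' hlim fun n => (hx n).le⟩
    have hanti : Antitone fun n => {x | u n < f x} := fun m n hmn x hx =>
      lt_of_le_of_lt (hu.monotone hmn) hx
    rw [hset, hanti.measure_iInter
      (fun n => (measurableSet_lt measurable_const hf).nullMeasurableSet) ⟨0, hfin _⟩]
    exact le_iInf fun n => (lt_rearr_iff.1 (hul n).2).le
  obtain ⟨c, -, hc⟩ := intermediate_value_Icc zero_le_one hcont.continuousOn ⟨h0, h1⟩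
  exact ⟨c, by rw [← hc, ENNReal.ofReal_toReal (hfin _)]⟩

/-- The superlevel sets of `f`, with ties broken by position, form a nested family `E t` of sets
of measure `t`. -/
theorem exists_nested_superlevel {f : ℝ → ℝ≥0∞} (hf : Measurable f) :
    ∃ E : ℝ → Set ℝ, ∀ t ∈ Ioo (0 : ℝ) 1, MeasurableSet (E t) ∧ vol01 (E t) = ENNReal.ofReal t ∧
      (∀ s ∈ Ioo (0 : ℝ) 1, s ≤ t → E s ⊆ E t) ∧
      ∀ a, vol01 (E t ∩ {x | a < f x}) = min (ENNReal.ofReal t) (vol01 {x | a < f x}) := by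
  choose! c hc using fun t (ht : t ∈ Ioo (0 : ℝ) 1) => exists_superlevel_measure_eq hf ht
  refine ⟨fun t => {x | rearr f t < f x} ∪ {x | f x = rearr f t} ∩ Iic (c t), fun t ht =>
    ⟨(measurableSet_lt measurable_const hf).union
      ((measurableSet_eq_fun hf measurable_const).inter measurableSet_Iic), hc t ht, ?_, ?_⟩⟩
  · intro s hs hst
    rcases hst.eq_or_lt with rfl | hst
    · exact subset_rfl
    rcases (rearr_antitone f hst.le).lt_or_eq with h | h
    · rintro x (hx | hx)
      · exact Or.inl (h.trans hx)
      · exact Or.inl (h.trans_eq hx.1.symm)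
    · simp only [← h]
      rcases le_total (c s) (c t) with hcs | hcs
      · exact union_subset_union_right _ (inter_subset_inter_right _ (Iic_subset_Iic.2 hcs))
      · have h1 := hc t ht
        have h2 := hc s hs
        rw [← h] at h2
        have h3 := h1.symm.le.trans ((measure_mono (union_subset_union_right _
          (inter_subset_inter_right _ (Iic_subset_Iic.2 hcs)))).trans h2.le)
        exact absurd ((ENNReal.ofReal_le_ofReal_iff hs.1.le).1 h3) (not_le.2 hst)
  · intro a
    rcases le_or_gt (rearr f t) a with h | h
    · have hsub : {x | a < f x} ⊆ {x | rearr f t < f x} ∪ {x | f x = rearr f t} ∩ Iic (c t) :=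
        fun x hx => Or.inl (h.trans_lt hx)
      rw [inter_eq_self_of_subset_right hsub, min_eq_right (rearr_le_iff.1 h)]
    · have hsub : {x | rearr f t < f x} ∪ {x | f x = rearr f t} ∩ Iic (c t) ⊆ {x | a < f x} := by
        rintro x (hx | hx)
        · exact h.trans hx
        · exact h.trans_eq hx.1.symm
      rw [inter_eq_self_of_subset_left hsub, hc t ht, min_eq_left (lt_rearr_iff.1 h).le]

/-- Equality is attained in the Hardy–Littlewood inequality by some function equimeasurable with
`h`, since Lebesgue measure has no atoms. -/
theorem exists_equimeasurable_lintegral_eq {f : ℝ → ℝ≥0∞} (hf : Measurable f) (h : ℝ → ℝ≥0∞) :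
    ∃ k : ℝ → ℝ≥0∞, Measurable k ∧ rearr k = rearr h ∧
      ∫⁻ x in Ioo (0 : ℝ) 1, f x * k x = ∫⁻ x in Ioo (0 : ℝ) 1, rearr f x * rearr h x := by
  obtain ⟨E, hE⟩ := exists_nested_superlevel hf
  let ι := {q : ℚ // (q : ℝ) ∈ Ioo (0 : ℝ) 1}
  let k : ℝ → ℝ≥0∞ := fun x => ⨆ q : ι, (E q.1).indicator (fun _ => rearr h q.1) x
  have hk : Measurable k := Measurable.iSup fun q => measurable_const.indicator (hE _ q.2).1
  have key : ∀ (b : ℝ≥0∞) (S : Set ℝ) (m : ℝ≥0∞),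
      (∀ t ∈ Ioo (0 : ℝ) 1, vol01 (E t ∩ S) = min (ENNReal.ofReal t) m) →
      vol01 ({x | b < k x} ∩ S) = min (vol01 {x | b < h x}) m := by
    intro b S m hS
    have hset : {x | b < k x} ∩ S = ⋃ q : ι, ({x | x ∈ E q.1 ∧ b < rearr h q.1} ∩ S) := by
      rw [← iUnion_inter]
      congr 1
      ext x
      simp only [mem_ofPred_eq, mem_iUnion, k, lt_iSup_iff]
      refine exists_congr fun q => ?_
      by_cases hx : x ∈ E q.1 <;> simp [hx]
    have hdir : Directed (· ⊆ ·) fun q : ι => {x | x ∈ E q.1 ∧ b < rearr h q.1} ∩ S := by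
      have hle : ∀ p q : ι, (p.1 : ℝ) ≤ q.1 → b < rearr h q.1 →
          {x | x ∈ E p.1 ∧ b < rearr h p.1} ∩ S ⊆ {x | x ∈ E q.1 ∧ b < rearr h q.1} ∩ S :=
        fun p q hpq hb x hx => ⟨⟨(hE _ q.2).2.2.1 _ p.2 hpq hx.1.1, hb⟩, hx.2⟩
      have hemp : ∀ p : ι, ¬ b < rearr h p.1 →
          ∀ T, {x | x ∈ E p.1 ∧ b < rearr h p.1} ∩ S ⊆ T :=
        fun p hp T x hx => absurd hx.1.2 hp
      intro p q
      by_cases hp : b < rearr h p.1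
      · by_cases hq : b < rearr h q.1
        · rcases le_total (p.1 : ℝ) q.1 with hpq | hpq
          · exact ⟨q, hle p q hpq hq, subset_rfl⟩
          · exact ⟨p, subset_rfl, hle q p hpq hp⟩
        · exact ⟨p, subset_rfl, hemp q hq _⟩
      · exact ⟨q, hemp p hp _, subset_rfl⟩
    rw [hset, hdir.measure_iUnion]
    refine le_antisymm (iSup_le fun q => ?_) (le_of_forall_lt fun x hx => ?_)
    · by_cases hq : b < rearr h q.1
      · simp only [hq, and_true]
        refine (hS _ q.2).le.trans (min_le_min_right _ (lt_rearr_iff.1 hq).le)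
      · simp [hq]
    · obtain ⟨hx1, hx2⟩ := lt_min_iff.1 hx
      obtain ⟨q, -, hxq, hqb⟩ := ENNReal.lt_iff_exists_rat_btwn.1 hx1
      have hq0 : 0 < (q : ℝ) := by
        by_contra h0
        rw [Real.toNNReal_of_nonpos (not_lt.1 h0)] at hxq
        simp at hxq
      have hq1 : (q : ℝ) < 1 := by
        have := hqb.trans_le (vol01_le_one _)
        rwa [← ENNReal.ofReal, ENNReal.ofReal_lt_one] at this
      refine lt_of_lt_of_le ?_ (le_iSup _ (⟨q, hq0, hq1⟩ : ι))
      have hbq : b < rearr h q := lt_rearr_iff.2 hqb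
      simp only [hbq, and_true]
      exact lt_of_lt_of_eq (lt_min hxq hx2) (hS _ ⟨hq0, hq1⟩).symm
  refine ⟨k, hk, rearr_congr fun b => ?_, ?_⟩
  · have := key b univ 1 fun t ht => by
      rw [inter_univ, (hE t ht).2.1, min_eq_left (ENNReal.ofReal_le_one.2 ht.2.le)]
    rwa [inter_univ, min_eq_left (vol01_le_one _)] at this
  · rw [lintegral_mul_eq_lintegral_measure_inter hf hk,
      lintegral_mul_eq_lintegral_measure_inter (measurable_rearr _) (measurable_rearr _)]
    refine lintegral_congr fun a => lintegral_congr fun b => ?_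
    rw [measure_inter_lt_rearr, inter_comm, key _ _ _ fun t ht => (hE t ht).2.2.2 _, min_comm]

section Associate

variable {ρ : (ℝ → ℝ≥0∞) → ℝ≥0∞}

theorem lintegral_le_assoc {f g : ℝ → ℝ≥0∞} (hg : MPlus g) (h : ρ g ≤ 1) :
    ∫⁻ x in Ioo (0 : ℝ) 1, f x * g x ≤ assoc ρ f :=
  le_iSup₂_of_le g hg (le_iSup_of_le h le_rfl)

theorem assoc_le_iff {f : ℝ → ℝ≥0∞} {c : ℝ≥0∞} :
    assoc ρ f ≤ c ↔ ∀ g, MPlus g → ρ g ≤ 1 → ∫⁻ x in Ioo (0 : ℝ) 1, f x * g x ≤ c := by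
  simp only [assoc, iSup_le_iff]

theorem assoc_mono {f g : ℝ → ℝ≥0∞} (h : ∀ᵐ x ∂vol01, f x ≤ g x) : assoc ρ f ≤ assoc ρ g := by
  refine assoc_le_iff.2 fun v hv hv1 => le_trans (lintegral_mono_ae ?_) (lintegral_le_assoc hv hv1)
  filter_upwards [h] with x hx
  gcongr

theorem assoc_smul (f : ℝ → ℝ≥0∞) {a : ℝ≥0∞} (ha : a ≠ ∞) :
    assoc ρ (fun x => a * f x) = a * assoc ρ f := by
  simp only [assoc, mul_assoc, lintegral_const_mul' a _ ha, ENNReal.mul_iSup]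

/-- Hölder's inequality for a norm and its associate functional. -/
theorem lintegral_mul_le_assoc_mul (hρ : IsRINorm ρ) (f : ℝ → ℝ≥0∞) {g : ℝ → ℝ≥0∞} (hg : MPlus g)
    (h : ρ g < ∞) : ∫⁻ x in Ioo (0 : ℝ) 1, f x * g x ≤ assoc ρ f * ρ g := by
  rcases eq_or_ne (ρ g) 0 with h0 | h0
  · have hg0 := (hρ.eq_zero_iff g hg).1 h0
    have : ∫⁻ x in Ioo (0 : ℝ) 1, f x * g x = 0 := by
      refine (lintegral_congr_ae ?_).trans lintegral_zero
      filter_upwards [hg0] with x hx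
      simp [hx]
    rw [this]
    exact zero_le
  · lift ρ g to ℝ≥0 using h.ne with r hr
    have hr0 : r ≠ 0 := by simpa using h0
    have h1 : ρ (fun x => (r⁻¹ : ℝ≥0) * g x) ≤ 1 := by
      rw [hρ.smul g hg, ← hr, ← ENNReal.coe_mul, inv_mul_cancel₀ hr0, ENNReal.coe_one]
    have h2 : ∫⁻ x in Ioo (0 : ℝ) 1, f x * ((r⁻¹ : ℝ≥0) * g x) ≤ assoc ρ f :=
      lintegral_le_assoc (hg.const_mul _) h1
    simp only [mul_left_comm (f _)] at h2
    rw [lintegral_const_mul' _ _ ENNReal.coe_ne_top, ENNReal.coe_inv hr0, mul_comm,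
      ← div_eq_mul_inv, ENNReal.div_le_iff (by simpa using hr0) ENNReal.coe_ne_top] at h2
    exact h2

/-- Any competitor `v` for `g^*` can be moved, by resonance, to an equimeasurable competitor for
`g`. -/
theorem assoc_rearr_le (hρ : IsRINorm ρ) {g : ℝ → ℝ≥0∞} (hg : MPlus g) :
    assoc ρ (rearr g) ≤ assoc ρ g := by
  refine assoc_le_iff.2 fun v hv hv1 => ?_
  obtain ⟨k, hk, hkr, hint⟩ := exists_equimeasurable_lintegral_eq hg.measurable_mk v
  refine (lintegral_mul_le_rearr (mplus_rearr g) hv).trans ?_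
  rw [rearr_rearr, rearr_congr_ae hg.ae_eq_mk, ← hint]
  refine le_trans (lintegral_le_assoc hk.aemeasurable ?_)
    (assoc_mono hg.ae_eq_mk.symm.le)
  rwa [← hρ.rearr_eq k hk.aemeasurable, hkr, hρ.rearr_eq v hv]

theorem setLIntegral_comp_div {c : ℝ} (hc : 0 < c) (a b : ℝ) (F : ℝ → ℝ≥0∞) :
    ∫⁻ x in Ioo (c * a) (c * b), F (x / c) = ENNReal.ofReal c * ∫⁻ x in Ioo a b, F x := by
  have hpre : Ioo (c * a) (c * b) = (fun x => c⁻¹ * x) ⁻¹' Ioo a b := by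
    ext x
    simp only [mem_Ioo, mem_preimage, ← div_eq_inv_mul, lt_div_iff₀ hc, div_lt_iff₀ hc]
    simp only [mul_comm]
  have hemb : MeasurableEmbedding fun x : ℝ => c⁻¹ * x :=
    (Homeomorph.mulLeft₀ c⁻¹ (inv_ne_zero hc.ne')).measurableEmbedding
  simp only [div_eq_inv_mul]
  rw [hpre, ← hemb.lintegral_map, ← hemb.restrict_map,
    Real.map_volume_mul_left (inv_ne_zero hc.ne'), inv_inv, abs_of_pos hc,
    Measure.restrict_smul, lintegral_smul_measure, smul_eq_mul]

/-- The dilation operators are bounded for the associate functional. -/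
theorem assoc_dilation_le (hρ : IsRINorm ρ) (w : ℝ → ℝ≥0∞) {c : ℝ} (hc : 1 ≤ c) :
    assoc ρ (fun t => rearr w (t / c)) ≤ ENNReal.ofReal c * assoc ρ (rearr w) := by
  have hc0 : 0 < c := zero_lt_one.trans_le hc
  have hu : Antitone fun t => rearr w (t / c) := fun s t hst =>
    rearr_antitone w (by gcongr)
  refine assoc_le_iff.2 fun v hv hv1 => ?_
  calc ∫⁻ t in Ioo (0 : ℝ) 1, rearr w (t / c) * v t
      ≤ ∫⁻ t in Ioo (0 : ℝ) 1, rearr (fun t => rearr w (t / c)) t * rearr v t :=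
        lintegral_mul_le_rearr hu.measurable.aemeasurable hv
    _ ≤ ∫⁻ t in Ioo (c * 0) (c * c⁻¹), rearr w (t / c) * rearr v (t / c) := by
        rw [mul_zero, mul_inv_cancel₀ hc0.ne']
        refine setLIntegral_mono' measurableSet_Ioo fun t ht => ?_
        gcongr
        · exact rearr_le_of_antitoneOn (hu.antitoneOn _) ht
        · exact rearr_antitone v (div_le_self ht.1.le hc)
    _ = ENNReal.ofReal c * ∫⁻ t in Ioo 0 c⁻¹, rearr w t * rearr v t :=
        setLIntegral_comp_div hc0 _ _ fun t => rearr w t * rearr v t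
    _ ≤ ENNReal.ofReal c * assoc ρ (rearr w) := by
        gcongr
        refine le_trans (lintegral_mono_set (Ioo_subset_Ioo_right (inv_le_one_of_one_le₀ hc)))
          (lintegral_le_assoc (mplus_rearr v) ?_)
        rwa [hρ.rearr_eq v hv]

end Associate

/-! ### The Lorentz–Luxemburg theorem -/

theorem IsRINorm.le_of_monotone_tendsto {ρ : (ℝ → ℝ≥0∞) → ℝ≥0∞} (hρ : IsRINorm ρ)
    {f : ℕ → ℝ → ℝ≥0∞} {g : ℝ → ℝ≥0∞} (hf : ∀ n, MPlus (f n)) (hm : Monotone f)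
    (hlim : ∀ᵐ x ∂vol01, Tendsto (fun n => f n x) atTop (𝓝 (g x))) {c : ℝ≥0∞}
    (hc : ∀ n, ρ (f n) ≤ c) : ρ g ≤ c := by
  have hg : MPlus g := aemeasurable_of_tendsto_metrizable_ae atTop hf hlim
  refine le_of_tendsto' (hρ.fatou f g hf hg ?_) hc
  filter_upwards [hlim] with x hx
  exact ⟨fun m n h => hm h x, hx⟩

theorem tendsto_min_natCast (y : ℝ≥0∞) :
    Tendsto (fun n : ℕ => min y (n : ℝ≥0∞)) atTop (𝓝 y) := by
  have : Tendsto (fun n : ℕ => min y (n : ℝ≥0∞)) atTop (𝓝 (min y ∞)) :=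
    tendsto_const_nhds.min ENNReal.tendsto_nat_nhds_top
  simpa using this

/-- The ball of radius `c` of a rearrangement-invariant space, intersected with `L²`. -/
def ballL2 (ρ : (ℝ → ℝ≥0∞) → ℝ≥0∞) (c : ℝ≥0) : Set (Lp ℝ 2 vol01) :=
  {u | ρ (fun x => ‖u x‖ₑ) ≤ c}

theorem mplus_enorm (u : Lp ℝ 2 vol01) : MPlus fun x => ‖u x‖ₑ :=
  (Lp.aestronglyMeasurable u).enorm

theorem convex_ballL2 {ρ : (ℝ → ℝ≥0∞) → ℝ≥0∞} (hρ : IsRINorm ρ) (c : ℝ≥0) :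
    Convex ℝ (ballL2 ρ c) := by
  intro u hu v hv a b ha hb hab
  lift a to ℝ≥0 using ha
  lift b to ℝ≥0 using hb
  have hab' : a + b = 1 := by exact_mod_cast hab
  have hmu := mplus_enorm u
  have hmv := mplus_enorm v
  calc ρ (fun x => ‖((a : ℝ) • u + (b : ℝ) • v : Lp ℝ 2 vol01) x‖ₑ)
      ≤ ρ (fun x => a * ‖u x‖ₑ + b * ‖v x‖ₑ) := by
        refine hρ.mono _ _ (mplus_enorm _) ((hmu.const_mul _).add (hmv.const_mul _)) ?_
        filter_upwards [Lp.coeFn_add ((a : ℝ) • u) ((b : ℝ) • v), Lp.coeFn_smul (a : ℝ) u,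
          Lp.coeFn_smul (b : ℝ) v] with x h1 h2 h3
        rw [h1, Pi.add_apply, h2, h3]
        refine (enorm_add_le _ _).trans_eq ?_
        simp
    _ ≤ ρ (fun x => a * ‖u x‖ₑ) + ρ (fun x => b * ‖v x‖ₑ) :=
        hρ.add_le _ _ (hmu.const_mul _) (hmv.const_mul _)
    _ = a * ρ (fun x => ‖u x‖ₑ) + b * ρ (fun x => ‖v x‖ₑ) := by
        rw [hρ.smul _ hmu, hρ.smul _ hmv]
    _ ≤ a * c + b * c := by
        gcongr
        · exact hu
        · exact hv
    _ = c := by rw [← add_mul, ← ENNReal.coe_add, hab', ENNReal.coe_one, one_mul]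

theorem isClosed_ballL2 {ρ : (ℝ → ℝ≥0∞) → ℝ≥0∞} (hρ : IsRINorm ρ) (c : ℝ≥0) :
    IsClosed (ballL2 ρ c) := by
  refine IsSeqClosed.isClosed fun u v hu huv => ?_
  obtain ⟨ns, -, hns⟩ := (tendstoInMeasure_of_tendsto_Lp huv).exists_seq_tendsto_ae
  have hm : ∀ n, MPlus fun x => ⨅ k : ℕ, ‖u (ns (n + k)) x‖ₑ := fun n =>
    AEMeasurable.iInf fun k => mplus_enorm _
  refine hρ.le_of_monotone_tendsto (f := fun n x => ⨅ k : ℕ, ‖u (ns (n + k)) x‖ₑ) hm ?_ ?_ fun n => ?_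
  · intro m n hmn x
    refine le_iInf fun k => (iInf_le _ (n - m + k)).trans_eq ?_
    rw [← add_assoc, Nat.add_sub_cancel' hmn]
  · filter_upwards [hns] with x hx
    have h1 := (continuous_enorm.tendsto _).comp hx
    have hmono : Monotone fun n => ⨅ k : ℕ, ‖u (ns (n + k)) x‖ₑ := by
      intro m n hmn
      refine le_iInf fun k => (iInf_le _ (n - m + k)).trans_eq ?_
      rw [← add_assoc, Nat.add_sub_cancel' hmn]
    have h2 := tendsto_atTop_iSup hmono
    have h3 : ⨆ n, ⨅ k : ℕ, ‖u (ns (n + k)) x‖ₑ = ‖v x‖ₑ := by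
      rw [← h1.liminf_eq, liminf_eq_iSup_iInf_of_nat']
      simp [add_comm]
    rwa [h3] at h2
  · refine (hρ.mono _ _ (hm n) (mplus_enorm (u (ns n))) (Eventually.of_forall fun x => ?_)).trans
      (hu (ns n))
    exact iInf_le _ 0

theorem le_assoc_assoc_of_bounded {ρ : (ℝ → ℝ≥0∞) → ℝ≥0∞} (hρ : IsRINorm ρ) {f : ℝ → ℝ≥0∞}
    (hf : MPlus f) {N : ℕ} (hN : ∀ x, f x ≤ N) : ρ f ≤ assoc (assoc ρ) f := by
  refine ENNReal.le_of_forall_nnreal_lt fun c hc => ?_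
  have hfin : ∀ x, f x ≠ ∞ := fun x => ne_top_of_le_ne_top (ENNReal.natCast_ne_top N) (hN x)
  have hfL : MemLp (fun x => (f x).toReal) 2 vol01 := by
    refine MemLp.of_bound hf.ennreal_toReal.aestronglyMeasurable N (Eventually.of_forall fun x => ?_)
    rw [Real.norm_of_nonneg ENNReal.toReal_nonneg]
    exact ENNReal.toReal_le_of_le_ofReal N.cast_nonneg (by simpa using hN x)
  have hnot : hfL.toLp ∉ ballL2 ρ c := by
    intro h
    refine absurd (le_trans (hρ.mono _ _ hf (mplus_enorm _) ?_) h) (not_le.2 hc)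
    filter_upwards [hfL.coeFn_toLp] with x hx
    rw [hx, Real.enorm_of_nonneg ENNReal.toReal_nonneg, ENNReal.ofReal_toReal (hfin x)]
  obtain ⟨φ, γ, hφ, hφf⟩ := geometric_hahn_banach_closed_point (convex_ballL2 hρ c)
    (isClosed_ballL2 hρ c) hnot
  obtain ⟨v, rfl⟩ := (InnerProductSpace.toDual ℝ (Lp ℝ 2 vol01)).surjective φ
  simp only [InnerProductSpace.toDual_apply_apply, L2.inner_def] at hφ hφf
  have hmv := mplus_enorm v
  have hγ : 0 < γ := by
    have h0 : (0 : Lp ℝ 2 vol01) ∈ ballL2 ρ c := by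
      have : ρ (fun x => ‖(0 : Lp ℝ 2 vol01) x‖ₑ) = 0 := by
        refine (hρ.eq_zero_iff _ (mplus_enorm _)).2 ?_
        filter_upwards [Lp.coeFn_zero ℝ 2 vol01] with x hx
        rw [hx]
        simp
      exact this.le.trans zero_le
    have h1 := hφ 0 h0
    have h2 : ∫ x in Ioo (0 : ℝ) 1, inner ℝ (v x) ((0 : Lp ℝ 2 vol01) x) = 0 := by
      rw [← L2.inner_def, inner_zero_right]
    rwa [h2] at h1
  -- Testing against `c sgn(v) min(w, n)` bounds the associate norm of `|v|`.
  have hassoc : ∀ w, MPlus w → ρ w ≤ 1 →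
      c * ∫⁻ x in Ioo (0 : ℝ) 1, ‖v x‖ₑ * w x ≤ ENNReal.ofReal γ := by
    intro w hw hw1
    have hstep : ∀ n : ℕ, ∫⁻ x in Ioo (0 : ℝ) 1, c * (‖v x‖ₑ * min (w x) n)
        ≤ ENNReal.ofReal γ := by
      intro n
      have hwm : MPlus fun x => min (w x) (n : ℝ≥0∞) := hw.min aemeasurable_const
      have hne : ∀ x, min (w x) (n : ℝ≥0∞) ≠ ∞ := fun x =>
        ne_top_of_le_ne_top (ENNReal.natCast_ne_top n) (min_le_right _ _)
      have hsgn : Measurable (fun y : ℝ => if 0 ≤ y then (1 : ℝ) else -1) :=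
        Measurable.ite measurableSet_Ici measurable_const measurable_const
      let z : ℝ → ℝ := fun x =>
        c * ((if 0 ≤ v x then (1 : ℝ) else -1) * (min (w x) (n : ℝ≥0∞)).toReal)
      have hzm : AEStronglyMeasurable z vol01 :=
        (((hsgn.comp_aemeasurable (Lp.aestronglyMeasurable v).aemeasurable).mul
          hwm.ennreal_toReal).const_mul _).aestronglyMeasurable
      have hze : ∀ x, ‖z x‖ₑ = c * min (w x) (n : ℝ≥0∞) := by
        intro x
        have h1 : ‖(if 0 ≤ v x then (1 : ℝ) else -1)‖ₑ = 1 := by split_ifs <;> simp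
        simp only [z, enorm_mul, h1, one_mul]
        rw [Real.enorm_of_nonneg ENNReal.toReal_nonneg, ENNReal.ofReal_toReal (hne x)]
        simp
      have hzL : MemLp z 2 vol01 := by
        refine MemLp.of_bound hzm (c * n) (Eventually.of_forall fun x => ?_)
        have := hze x
        rw [← ofReal_norm] at this
        refine (ENNReal.ofReal_le_ofReal_iff (by positivity)).1 (this.le.trans ?_)
        rw [ENNReal.ofReal_mul (by positivity)]
        simp only [ENNReal.ofReal_coe_nnreal, ENNReal.ofReal_natCast]
        gcongr
        exact min_le_right _ _
      obtain ⟨u, hu⟩ : ∃ u : Lp ℝ 2 vol01, u =ᵐ[vol01] z := ⟨hzL.toLp z, hzL.coeFn_toLp⟩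
      have hmem : u ∈ ballL2 ρ c := by
        have h1 : ρ (fun x => ‖u x‖ₑ) ≤ ρ (fun x => c * min (w x) (n : ℝ≥0∞)) := by
          refine hρ.mono _ _ (mplus_enorm _) (hwm.const_mul _) ?_
          filter_upwards [hu] with x hx
          rw [hx, hze]
        refine h1.trans ?_
        rw [hρ.smul _ hwm]
        refine (mul_le_mul_right ((hρ.mono _ w hwm hw
          (Eventually.of_forall fun x => min_le_left _ _)).trans hw1) _).trans_eq (mul_one _)
      have hlt := hφ _ hmem
      have hint := L2.integrable_inner (𝕜 := ℝ) v u
      have hval : ∀ᵐ x ∂vol01, inner ℝ (v x) (u x)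
          = c * (|v x| * (min (w x) (n : ℝ≥0∞)).toReal) := by
        filter_upwards [hu] with x hx
        rw [hx]
        simp only [z, RCLike.inner_apply, conj_trivial]
        split_ifs with h
        · rw [abs_of_nonneg h]; ring
        · rw [abs_of_neg (not_le.1 h)]; ring
      have h1 : ∫⁻ x in Ioo (0 : ℝ) 1, c * (‖v x‖ₑ * min (w x) n)
          = ENNReal.ofReal (∫ x in Ioo (0 : ℝ) 1, inner ℝ (v x) (u x)) := by
        rw [ofReal_integral_eq_lintegral_ofReal hint]
        · refine lintegral_congr_ae ?_
          filter_upwards [hval] with x hx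
          rw [hx, ENNReal.ofReal_mul c.coe_nonneg, ENNReal.ofReal_mul (abs_nonneg _),
            ENNReal.ofReal_toReal (hne x), ENNReal.ofReal_coe_nnreal, Real.enorm_eq_ofReal_abs]
        · filter_upwards [hval] with x hx
          rw [hx]
          positivity
      rw [h1]
      exact ENNReal.ofReal_le_ofReal hlt.le
    rw [← lintegral_const_mul' _ _ ENNReal.coe_ne_top]
    refine le_of_tendsto' (lintegral_tendsto_of_tendsto_of_monotone
      (f := fun (n : ℕ) x => c * (‖v x‖ₑ * min (w x) n)) (fun n => ?_) ?_ ?_) hstep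
    · exact (hmv.mul (hw.min aemeasurable_const)).const_mul _
    · refine Eventually.of_forall fun x m n hmn => ?_
      dsimp only
      gcongr
    · refine Eventually.of_forall fun x => ?_
      refine ENNReal.Tendsto.const_mul ?_ (Or.inr ENNReal.coe_ne_top)
      exact ENNReal.Tendsto.const_mul (tendsto_min_natCast _) (Or.inr enorm_ne_top)
  have hγ0 : ENNReal.ofReal γ ≠ 0 := by simpa using hγ
  set a : ℝ≥0∞ := c / ENNReal.ofReal γ with ha
  have hatop : a ≠ ∞ := ENNReal.div_ne_top ENNReal.coe_ne_top hγ0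
  have h1 : assoc ρ (fun x => a * ‖v x‖ₑ) ≤ 1 := by
    refine assoc_le_iff.2 fun w hw hw1 => ?_
    simp only [mul_assoc]
    rw [lintegral_const_mul' _ _ hatop, ha, div_eq_mul_inv, mul_right_comm, ← div_eq_mul_inv]
    exact ENNReal.div_le_of_le_mul (by simpa using hassoc w hw hw1)
  have h2 : ENNReal.ofReal γ ≤ ∫⁻ x in Ioo (0 : ℝ) 1, f x * ‖v x‖ₑ := by
    refine (ENNReal.ofReal_le_ofReal hφf.le).trans ?_
    refine (Real.ofReal_le_enorm _).trans ((enorm_integral_le_lintegral_enorm _).trans_eq ?_)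
    refine lintegral_congr_ae ?_
    filter_upwards [hfL.coeFn_toLp] with x hx
    rw [hx]
    simp only [RCLike.inner_apply, conj_trivial, enorm_mul]
    rw [Real.enorm_of_nonneg ENNReal.toReal_nonneg, ENNReal.ofReal_toReal (hfin x)]
  calc (c : ℝ≥0∞) = a * ENNReal.ofReal γ := by
        rw [ha, ENNReal.div_mul_cancel hγ0 ENNReal.ofReal_ne_top]
    _ ≤ a * ∫⁻ x in Ioo (0 : ℝ) 1, f x * ‖v x‖ₑ := by gcongr
    _ = ∫⁻ x in Ioo (0 : ℝ) 1, f x * (a * ‖v x‖ₑ) := by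
        rw [← lintegral_const_mul' _ _ hatop]
        simp only [mul_left_comm a]
    _ ≤ _ := lintegral_le_assoc (hmv.const_mul _) h1

/-- The nontrivial inequality of the Lorentz–Luxemburg theorem. -/
theorem le_assoc_assoc {ρ : (ℝ → ℝ≥0∞) → ℝ≥0∞} (hρ : IsRINorm ρ) {f : ℝ → ℝ≥0∞}
    (hf : MPlus f) : ρ f ≤ assoc (assoc ρ) f := by
  have hm : ∀ n : ℕ, MPlus fun x => min (f x) (n : ℝ≥0∞) := fun n => hf.min aemeasurable_const
  refine hρ.le_of_monotone_tendsto (f := fun (n : ℕ) x => min (f x) (n : ℝ≥0∞)) hm ?_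
    (Eventually.of_forall fun x => tendsto_min_natCast _) fun n => ?_
  · intro m n hmn x
    dsimp only
    gcongr
  · exact (le_assoc_assoc_of_bounded hρ (hm n) (N := n) fun x => min_le_right _ _).trans
      (assoc_mono (Eventually.of_forall fun x => min_le_left _ _))

/-! ### The optimal target norm -/

/-- Tonelli's theorem on the triangle `0 < t < s < 1`. -/
theorem lintegral_triangle {μ ν : Measure ℝ} [SFinite μ] [SFinite ν] {a b : ℝ → ℝ≥0∞}
    (ha : AEMeasurable a (ν.restrict (Ioo 0 1))) (hb : AEMeasurable b (μ.restrict (Ioo 0 1))) :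
    ∫⁻ t in Ioo (0 : ℝ) 1, (∫⁻ s in Ioo t 1, a s ∂ν) * b t ∂μ =
      ∫⁻ s in Ioo (0 : ℝ) 1, a s * ∫⁻ t in Ioo 0 s, b t ∂μ ∂ν := by
  have h1 : ∀ t ∈ Ioo (0 : ℝ) 1, (∫⁻ s in Ioo t 1, a s ∂ν) * b t =
      ∫⁻ s in Ioo (0 : ℝ) 1, {p : ℝ × ℝ | p.1 < p.2}.indicator (fun p => a p.2 * b p.1) (t, s) ∂ν := by
    intro t ht
    have hsub : Ioi t ∩ Ioo 0 1 = Ioo t 1 := by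
      ext s
      simp only [mem_inter_iff, mem_Ioi, mem_Ioo]
      exact ⟨fun h => ⟨h.1, h.2.2⟩, fun h => ⟨h.1, ht.1.trans h.1, h.2⟩⟩
    have h2 : (fun s => {p : ℝ × ℝ | p.1 < p.2}.indicator (fun p => a p.2 * b p.1) (t, s)) =
        (Ioi t).indicator fun s => a s * b t := by
      ext s; simp [indicator]
    rw [h2, lintegral_indicator measurableSet_Ioi, Measure.restrict_restrict measurableSet_Ioi,
      hsub, lintegral_mul_const'']
    exact ha.mono_measure (Measure.restrict_mono (Ioo_subset_Ioo_left ht.1.le) le_rfl)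
  have h3 : ∀ s ∈ Ioo (0 : ℝ) 1, a s * ∫⁻ t in Ioo 0 s, b t ∂μ =
      ∫⁻ t in Ioo (0 : ℝ) 1, {p : ℝ × ℝ | p.1 < p.2}.indicator (fun p => a p.2 * b p.1) (t, s) ∂μ := by
    intro s hs
    have hsub : Iio s ∩ Ioo 0 1 = Ioo 0 s := by
      ext t
      simp only [mem_inter_iff, mem_Iio, mem_Ioo]
      exact ⟨fun h => ⟨h.2.1, h.1⟩, fun h => ⟨h.2, h.1, h.2.trans hs.2⟩⟩
    have h2 : (fun t => {p : ℝ × ℝ | p.1 < p.2}.indicator (fun p => a p.2 * b p.1) (t, s)) =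
        (Iio s).indicator fun t => a s * b t := by
      ext s; simp [indicator]
    rw [h2, lintegral_indicator measurableSet_Iio, Measure.restrict_restrict measurableSet_Iio,
      hsub, lintegral_const_mul'']
    exact hb.mono_measure (Measure.restrict_mono (Ioo_subset_Ioo_right hs.2.le) le_rfl)
  rw [setLIntegral_congr_fun measurableSet_Ioo h1, setLIntegral_congr_fun measurableSet_Ioo h3]
  refine lintegral_lintegral_swap ?_
  exact ((ha.comp_snd).mul (hb.comp_fst)).indicator (measurableSet_lt measurable_fst measurable_snd)

section Quasiconcave

variable {I : ℝ → ℝ}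

theorem IsQuasiconcave.pos (hI : IsQuasiconcave I) {t : ℝ} (ht : t ∈ Ioo (0 : ℝ) 1) : 0 < I t :=
  (hI.bijOn.mapsTo ht).1

theorem IsQuasiconcave.le_one (hI : IsQuasiconcave I) {t : ℝ} (ht : t ∈ Ioo (0 : ℝ) 1) : I t ≤ 1 :=
  (hI.bijOn.mapsTo ht).2.le

theorem IsQuasiconcave.self_le (hI : IsQuasiconcave I) {t : ℝ} (ht : t ∈ Ioo (0 : ℝ) 1) :
    t ≤ I t := by
  have h1 : Tendsto (fun s => I s / s) (𝓝[<] 1) (𝓝 (1 / 1)) :=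
    hI.tendsto_one.div (tendsto_id.mono_left nhdsWithin_le_nhds) one_ne_zero
  have h2 : (1 : ℝ) / 1 ≤ I t / t := by
    refine le_of_tendsto h1 ?_
    filter_upwards [Ioo_mem_nhdsLT ht.2] with s hs
    exact hI.antitoneOn ht ⟨ht.1.trans hs.1, hs.2⟩ hs.1.le
  rwa [div_one, le_div_iff₀ ht.1, one_mul] at h2

theorem IsQuasiconcave.aemeasurable (hI : IsQuasiconcave I) :
    AEMeasurable (fun t => ENNReal.ofReal (I t)) vol01 :=
  aemeasurable_restrict_of_monotoneOn measurableSet_Ioo fun _ hs _ ht h =>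
    ENNReal.ofReal_le_ofReal (hI.monotoneOn hs ht h)

theorem antitone_opH (I : ℝ → ℝ) (f : ℝ → ℝ≥0∞) : Antitone (opH I f) := fun _ _ h =>
  lintegral_mono_set (Ioo_subset_Ioo_left h)

end Quasiconcave

/-- The operator `R_I h(t) = (1 / I(t)) ∫₀ᵗ h^*`, which is dual to `H_I` on nonincreasing
functions. -/
noncomputable def opR (I : ℝ → ℝ) (h : ℝ → ℝ≥0∞) (t : ℝ) : ℝ≥0∞ :=
  (∫⁻ s in Ioo 0 t, rearr h s) / ENNReal.ofReal (I t)

/-- The norm of the optimal target space: the functional dual to `h ↦ ‖R_I h‖_{X'}`, with the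
pairing taken on rearrangements, which makes rearrangement invariance immediate. -/
noncomputable def optNorm (I : ℝ → ℝ) (ρ : (ℝ → ℝ≥0∞) → ℝ≥0∞) (f : ℝ → ℝ≥0∞) : ℝ≥0∞ :=
  ⨆ (h : ℝ → ℝ≥0∞) (_ : MPlus h) (_ : assoc ρ (opR I h) ≤ 1),
    ∫⁻ t in Ioo (0 : ℝ) 1, rearr f t * rearr h t

section OptNorm

variable {I : ℝ → ℝ} {ρ : (ℝ → ℝ≥0∞) → ℝ≥0∞}

theorem mplus_opR (hI : IsQuasiconcave I) (h : ℝ → ℝ≥0∞) : MPlus (opR I h) := by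
  have hm : Monotone fun t => ∫⁻ s in Ioo 0 t, rearr h s := fun _ _ hst =>
    lintegral_mono_set (Ioo_subset_Ioo_right hst)
  exact hm.measurable.aemeasurable.div hI.aemeasurable

theorem optNorm_le_iff {f : ℝ → ℝ≥0∞} {c : ℝ≥0∞} : optNorm I ρ f ≤ c ↔
    ∀ h, MPlus h → assoc ρ (opR I h) ≤ 1 →
      ∫⁻ t in Ioo (0 : ℝ) 1, rearr f t * rearr h t ≤ c := by
  simp only [optNorm, iSup_le_iff]

theorem lintegral_le_optNorm (f : ℝ → ℝ≥0∞) {h : ℝ → ℝ≥0∞} (hh : MPlus h) {c : ℝ≥0}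
    (hc : c ≠ 0) (hle : assoc ρ (opR I h) ≤ c) :
    ∫⁻ t in Ioo (0 : ℝ) 1, rearr f t * rearr h t ≤ c * optNorm I ρ f := by
  have hci : c⁻¹ ≠ 0 := inv_ne_zero hc
  have hc' : (c : ℝ≥0∞) * (c⁻¹ : ℝ≥0) = 1 := by
    rw [← ENNReal.coe_mul, mul_inv_cancel₀ hc, ENNReal.coe_one]
  have h1 : opR I (fun x => (c⁻¹ : ℝ≥0) * h x) = fun t => (c⁻¹ : ℝ≥0) * opR I h t := by
    ext t
    simp only [opR, rearr_smul h hci]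
    rw [lintegral_const_mul' _ _ ENNReal.coe_ne_top, mul_div_assoc]
  have h2 : assoc ρ (opR I fun x => (c⁻¹ : ℝ≥0) * h x) ≤ 1 := by
    rw [h1, assoc_smul _ ENNReal.coe_ne_top]
    calc _ ≤ ((c⁻¹ : ℝ≥0) : ℝ≥0∞) * c := by gcongr
      _ = 1 := by rw [mul_comm, hc']
  have h3 := optNorm_le_iff.1 (le_refl (optNorm I ρ f)) _ (hh.const_mul _) h2
  simp only [rearr_smul h hci, mul_left_comm (rearr f _)] at h3
  rw [lintegral_const_mul' _ _ ENNReal.coe_ne_top] at h3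
  calc _ = (c : ℝ≥0∞) * ((c⁻¹ : ℝ≥0) * ∫⁻ t in Ioo (0 : ℝ) 1, rearr f t * rearr h t) := by
        rw [← mul_assoc, hc', one_mul]
    _ ≤ _ := by gcongr

/-- Obtained by testing the associate functional against a constant function. -/
theorem exists_lintegral_rearr_le (hI : IsQuasiconcave I) (hρ : IsRINorm ρ) :
    ∃ C : ℝ≥0, ∀ h : ℝ → ℝ≥0∞,
      ∫⁻ t in Ioo (0 : ℝ) 1, rearr h t ≤ C * assoc ρ (opR I h) := by
  obtain ⟨r, hr⟩ : ∃ r : ℝ≥0, (r : ℝ≥0∞) = ρ fun _ => 1 :=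
    ⟨_, ENNReal.coe_toNNReal hρ.one_lt_top.ne⟩
  set c : ℝ≥0 := (r + 1)⁻¹ with hc
  have hc0 : c ≠ 0 := by positivity
  have hρc : ρ (fun _ => c * 1) ≤ 1 := by
    rw [hρ.smul _ aemeasurable_const, ← hr, ← ENNReal.coe_mul, ENNReal.coe_le_one_iff, hc]
    exact inv_mul_le_one_of_le₀ (le_add_of_nonneg_right zero_le) (by positivity)
  refine ⟨4 * c⁻¹, fun h => ?_⟩
  set A := ∫⁻ t in Ioo (0 : ℝ) (1 / 2), rearr h t with hA
  have h1 : ∫⁻ t in Ioo (0 : ℝ) 1, rearr h t ≤ 2 * A := by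
    have h2 := setLIntegral_comp_div zero_lt_two 0 (1 / 2) (rearr h)
    rw [mul_zero, mul_one_div_cancel two_ne_zero, ENNReal.ofReal_ofNat] at h2
    rw [← h2]
    exact setLIntegral_mono' measurableSet_Ioo fun t ht =>
      rearr_antitone h (div_le_self ht.1.le one_le_two)
  have h2 : A * c * 2⁻¹ ≤ assoc ρ (opR I h) := by
    refine le_trans ?_ (lintegral_le_assoc aemeasurable_const hρc)
    calc A * c * 2⁻¹ = ∫⁻ t in Ioo (1 / 2 : ℝ) 1, A * c := by
          rw [setLIntegral_const, Real.volume_Ioo, show (1 : ℝ) - 1 / 2 = 2⁻¹ by norm_num,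
            ENNReal.ofReal_inv_of_pos zero_lt_two, ENNReal.ofReal_ofNat]
      _ ≤ ∫⁻ t in Ioo (1 / 2 : ℝ) 1, opR I h t * (c * 1) := by
          refine setLIntegral_mono' measurableSet_Ioo fun t ht => ?_
          have ht' : t ∈ Ioo (0 : ℝ) 1 := ⟨by linarith [ht.1], ht.2⟩
          rw [mul_one]
          gcongr
          refine (ENNReal.le_div_iff_mul_le (Or.inl ?_) (Or.inl ENNReal.ofReal_ne_top)).2 ?_
          · simpa using hI.pos ht'
          · calc A * ENNReal.ofReal (I t) ≤ A * 1 := by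
                  gcongr
                  exact ENNReal.ofReal_le_one.2 (hI.le_one ht')
              _ ≤ _ := by
                  rw [mul_one]
                  exact lintegral_mono_set (Ioo_subset_Ioo_right ht.1.le)
      _ ≤ _ := lintegral_mono_set (Ioo_subset_Ioo_left (by norm_num))
  calc _ ≤ 2 * A := h1
    _ = 4 * (c⁻¹ * c : ℝ≥0) * 2⁻¹ * A := by
        rw [inv_mul_cancel₀ hc0, ENNReal.coe_one, mul_one, show (4 : ℝ≥0∞) = 2 * 2 by norm_num,
          mul_assoc 2 2, ENNReal.mul_inv_cancel two_ne_zero ENNReal.ofNat_ne_top, mul_one]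
    _ = (4 * c⁻¹ : ℝ≥0) * (A * c * 2⁻¹) := by push_cast; ring
    _ ≤ _ := by gcongr

theorem exists_lintegral_le_optNorm (hI : IsQuasiconcave I) (hρ : IsRINorm ρ) :
    ∃ C : ℝ≥0, ∀ f, MPlus f → ∫⁻ x in Ioo (0 : ℝ) 1, f x ≤ C * optNorm I ρ f := by
  obtain ⟨C, hC⟩ := hρ.lintegral_le
  refine ⟨C + 1, fun f hf => ?_⟩
  have hone : ∀ t ∈ Ioo (0 : ℝ) 1, rearr (fun _ => 1) t ≤ 1 := fun t ht =>
    rearr_le_of_antitoneOn (u := fun _ => 1) antitoneOn_const ht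
  have h1 : assoc ρ (opR I fun _ => 1) ≤ (C + 1 : ℝ≥0) := by
    refine assoc_le_iff.2 fun g hg hg1 => ?_
    calc ∫⁻ x in Ioo (0 : ℝ) 1, opR I (fun _ => 1) x * g x ≤ ∫⁻ x in Ioo (0 : ℝ) 1, g x := by
          refine setLIntegral_mono' measurableSet_Ioo fun t ht => ?_
          refine mul_le_of_le_one_left' ?_
          refine ENNReal.div_le_of_le_mul ?_
          rw [one_mul]
          calc ∫⁻ s in Ioo 0 t, rearr (fun _ => 1) s ≤ ∫⁻ s in Ioo 0 t, 1 :=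
                setLIntegral_mono' measurableSet_Ioo fun s hs => hone s ⟨hs.1, hs.2.trans ht.2⟩
            _ = ENNReal.ofReal t := by simp
            _ ≤ _ := ENNReal.ofReal_le_ofReal (hI.self_le ht)
      _ ≤ C * ρ g := hC g hg
      _ ≤ C * 1 := by gcongr
      _ ≤ _ := by simp
  calc ∫⁻ x in Ioo (0 : ℝ) 1, f x = ∫⁻ x in Ioo (0 : ℝ) 1, f x * 1 := by simp
    _ ≤ ∫⁻ x in Ioo (0 : ℝ) 1, rearr f x * rearr (fun _ => 1) x :=
        lintegral_mul_le_rearr hf aemeasurable_const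
    _ ≤ _ := lintegral_le_optNorm f aemeasurable_const (by positivity) h1

theorem isRINorm_optNorm (hI : IsQuasiconcave I) (hρ : IsRINorm ρ) : IsRINorm (optNorm I ρ) := by
  have hmono : ∀ f g, (∀ᵐ x ∂vol01, f x ≤ g x) → optNorm I ρ f ≤ optNorm I ρ g := by
    intro f g h
    refine iSup₂_mono fun w _ => iSup_mono fun _ => lintegral_mono fun t => ?_
    dsimp only
    gcongr
    exact rearr_mono h t
  have hzero : ∀ f, f =ᵐ[vol01] 0 → optNorm I ρ f = 0 := by
    intro f hf
    have h0 : ∀ t, rearr f t = 0 := fun t => by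
      rw [rearr_congr_ae hf, ← nonpos_iff_eq_zero, rearr_le_iff]
      simp
    simp [optNorm, h0]
  have hL1 := exists_lintegral_le_optNorm hI hρ
  refine ⟨fun f hf => ⟨fun h => ?_, hzero f⟩, ?_, ?_, fun f g _ _ => hmono f g, ?_, ?_, hL1, ?_⟩
  · obtain ⟨C, hC⟩ := hL1
    have h1 := hC f hf
    rw [h, mul_zero, nonpos_iff_eq_zero] at h1
    exact (lintegral_eq_zero_iff' hf).1 h1
  · intro f hf a
    rcases eq_or_ne a 0 with rfl | ha
    · rw [hzero _ (Eventually.of_forall fun x => by simp), ENNReal.coe_zero, zero_mul]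
    · simp only [optNorm, rearr_smul f ha, mul_assoc, lintegral_const_mul' _ _ ENNReal.coe_ne_top,
        ENNReal.mul_iSup]
  · intro f g hf hg
    refine optNorm_le_iff.2 fun h hh h1 => ?_
    calc _ ≤ ∫⁻ t in Ioo (0 : ℝ) 1, (rearr f t + rearr g t) * rearr h t :=
          lintegral_mul_rearr_mono (mplus_rearr _) ((mplus_rearr f).add (mplus_rearr g))
            (fun t ht => setLIntegral_rearr_add_le hf hg ht) h
      _ = (∫⁻ t in Ioo (0 : ℝ) 1, rearr f t * rearr h t)
          + ∫⁻ t in Ioo (0 : ℝ) 1, rearr g t * rearr h t := by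
          simp only [add_mul]
          exact lintegral_add_left ((measurable_rearr f).mul (measurable_rearr h)) _
      _ ≤ _ := add_le_add (optNorm_le_iff.1 le_rfl h hh h1) (optNorm_le_iff.1 le_rfl h hh h1)
  · intro f g hf hg h
    have hlim : ∀ᵐ x ∂vol01, ∀ n, f n x ≤ g x := by
      filter_upwards [h] with x hx n
      exact hx.1.ge_of_tendsto hx.2 n
    have hm : Monotone fun n => optNorm I ρ (f n) := fun m n hmn => hmono _ _ (by
      filter_upwards [h] with x hx
      exact hx.1 hmn)
    have heq : optNorm I ρ g = ⨆ n, optNorm I ρ (f n) := by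
      refine le_antisymm (optNorm_le_iff.2 fun w hw hw1 => ?_)
        (iSup_le fun n => hmono _ _ (by filter_upwards [hlim] with x hx using hx n))
      simp only [rearr_iSup h, ENNReal.iSup_mul]
      rw [lintegral_iSup (f := fun n t => rearr (f n) t * rearr w t)
        (fun n => (measurable_rearr _).mul (measurable_rearr _))]
      · exact iSup_mono fun n => optNorm_le_iff.1 le_rfl w hw hw1
      · intro m n hmn t
        dsimp only
        gcongr
        refine rearr_mono ?_ t
        filter_upwards [h] with x hx
        exact hx.1 hmn
    rw [heq]
    exact tendsto_atTop_iSup hm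
  · obtain ⟨C, hC⟩ := exists_lintegral_rearr_le hI hρ
    refine lt_of_le_of_lt (optNorm_le_iff.2 fun h hh h1 => ?_) (ENNReal.coe_lt_top (r := C))
    calc _ ≤ ∫⁻ t in Ioo (0 : ℝ) 1, rearr h t := by
          refine setLIntegral_mono' measurableSet_Ioo fun t ht => mul_le_of_le_one_left' ?_
          exact rearr_le_of_antitoneOn (u := fun _ => 1) antitoneOn_const ht
      _ ≤ C * assoc ρ (opR I h) := hC h
      _ ≤ C * 1 := by gcongr
      _ = C := mul_one _
  · intro f _
    simp only [optNorm, rearr_rearr]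

/-- The duality between `H_I` and `R_I`. -/
theorem lintegral_opH_mul_rearr (hI : IsQuasiconcave I) {f : ℝ → ℝ≥0∞} (hf : MPlus f)
    (h : ℝ → ℝ≥0∞) : ∫⁻ t in Ioo (0 : ℝ) 1, opH I f t * rearr h t =
      ∫⁻ t in Ioo (0 : ℝ) 1, opR I h t * f t := by
  simp only [opH]
  rw [lintegral_triangle (a := fun s => f s / ENNReal.ofReal (I s)) (hf.div hI.aemeasurable)
    (mplus_rearr h)]
  refine lintegral_congr fun t => ?_
  simp only [opR, div_eq_mul_inv]
  ring

theorem isOptimalTarget_optNorm (hI : IsQuasiconcave I) (hρ : IsRINorm ρ) :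
    IsOptimalTarget (opH I) ρ (optNorm I ρ) := by
  refine ⟨isRINorm_optNorm hI hρ, ⟨1, fun f hf hfin => optNorm_le_iff.2 fun h hh h1 => ?_⟩, ?_⟩
  · calc _ ≤ ∫⁻ t in Ioo (0 : ℝ) 1, opH I f t * rearr h t := by
          refine setLIntegral_mono' measurableSet_Ioo fun t ht => ?_
          gcongr
          exact rearr_le_of_antitoneOn ((antitone_opH I f).antitoneOn _) ht
      _ = ∫⁻ t in Ioo (0 : ℝ) 1, opR I h t * f t := lintegral_opH_mul_rearr hI hf h
      _ ≤ assoc ρ (opR I h) * ρ f := lintegral_mul_le_assoc_mul hρ _ hf hfin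
      _ ≤ _ := by
          rw [ENNReal.coe_one]
          gcongr
  · rintro τ hτ ⟨C, hC⟩
    -- `C + 1` instead of `C` makes the constant nonzero.
    refine ⟨C + 1, fun f hf _ => (le_assoc_assoc hτ hf).trans (assoc_le_iff.2 fun g hg hg1 => ?_)⟩
    refine (lintegral_mul_le_rearr hf hg).trans
      (lintegral_le_optNorm f hg (by positivity) (assoc_le_iff.2 fun v hv hv1 => ?_))
    have hH : τ (opH I v) ≤ C := calc
      _ ≤ C * ρ v := hC v hv (hv1.trans_lt ENNReal.one_lt_top)
      _ ≤ C * 1 := by gcongr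
      _ = C := mul_one _
    calc _ = ∫⁻ t in Ioo (0 : ℝ) 1, rearr g t * opH I v t := by
          rw [← lintegral_opH_mul_rearr hI hv]
          simp only [mul_comm]
      _ ≤ assoc τ (rearr g) * τ (opH I v) :=
          lintegral_mul_le_assoc_mul hτ _ (antitone_opH I v).measurable.aemeasurable
            (hH.trans_lt ENNReal.coe_lt_top)
      _ ≤ 1 * C := by
          gcongr
          exact (assoc_rearr_le hτ hg).trans hg1
      _ ≤ _ := by simp

end OptNorm

/-! ### The explicit norm is dominated by the optimal norm -/

theorem setLIntegral_Ioo_add (φ : ℝ → ℝ≥0∞) {a b c : ℝ} (hab : a < b) (hbc : b ≤ c) :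
    ∫⁻ x in Ioo a c, φ x = (∫⁻ x in Ioo a b, φ x) + ∫⁻ x in Ioo b c, φ x := by
  rw [← Ioo_union_Ico_eq_Ioo hab hbc, lintegral_union measurableSet_Ico,
    setLIntegral_congr Ioo_ae_eq_Ico.symm]
  exact Set.disjoint_left.2 fun x hx hx' => absurd hx.2 (not_lt.2 hx'.1)

theorem setLIntegral_Ioo_zero_le {h : ℝ → ℝ≥0∞} {t : ℝ} (ht : 0 < t) {c : ℝ≥0∞}
    (hc : ∀ a, 0 < a → a < t / 2 → ∫⁻ x in Ioo a t, h x ≤ c) : ∫⁻ x in Ioo 0 t, h x ≤ c := by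
  have hset : Ioo 0 t = ⋃ n : ℕ, Ioo (t / (n + 3)) t := by
    ext x
    simp only [mem_iUnion, mem_Ioo]
    constructor
    · rintro ⟨h0, h1⟩
      obtain ⟨n, hn⟩ := exists_nat_gt (t / x)
      refine ⟨n, ?_, h1⟩
      rw [div_lt_iff₀ (by positivity)]
      rw [div_lt_iff₀ h0] at hn
      nlinarith
    · rintro ⟨n, h0, h1⟩
      exact ⟨lt_trans (by positivity) h0, h1⟩
  have hm : Monotone fun n : ℕ => Ioo (t / (n + 3)) t := fun m n hmn =>
    Ioo_subset_Ioo_left (by gcongr)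
  rw [hset, setLIntegral_iUnion_of_directed _ hm.directed_le]
  refine iSup_le fun n => hc _ (by positivity) ?_
  exact div_lt_div_of_pos_left ht two_pos (by linarith [n.cast_nonneg (α := ℝ)])

/-- A quasiconcave function vanishing at `0` is equivalent, for some `h`, both to `t ↦ ∫₀ᵗ h` and
to `t ↦ ∫₀ᵗ h^*`. -/
theorem exists_density_of_quasiconcave {G : ℝ → ℝ≥0∞} (hG : Monotone G)
    (hfin : ∀ t ∈ Ioo (0 : ℝ) 1, G t ≠ ∞)
    (hanti : AntitoneOn (fun t => G t / ENNReal.ofReal t) (Ioo 0 1))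
    (h0 : Tendsto G (𝓝[>] 0) (𝓝 0)) :
    ∃ h : ℝ → ℝ≥0∞, Measurable h ∧ ∀ t ∈ Ioo (0 : ℝ) 1,
      G t ≤ 2 * ∫⁻ s in Ioo 0 t, h s ∧ ∫⁻ s in Ioo 0 t, rearr h s ≤ 2 * G t := by
  set φ : ℝ → ℝ≥0∞ := fun t => G t / ENNReal.ofReal t with hφ
  have hφm : Measurable φ := hG.measurable.div ENNReal.measurable_ofReal
  have hofne : ∀ {t : ℝ}, 0 < t → ENNReal.ofReal t ≠ 0 := fun h => by simpa using h
  have hφfin : ∀ t ∈ Ioo (0 : ℝ) 1, φ t ≠ ∞ := fun t ht =>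
    ENNReal.div_ne_top (hfin t ht) (hofne ht.1)
  have hφG : ∀ t, 0 < t → φ t * ENNReal.ofReal t = G t := fun t ht =>
    ENNReal.div_mul_cancel (hofne ht) ENNReal.ofReal_ne_top
  -- The density is the scaled difference quotient `(G(s) - G(s/2)) / s`.
  set h : ℝ → ℝ≥0∞ := fun s => φ s - φ (s / 2) / 2 with hh
  have hhm : Measurable h := hφm.sub ((hφm.comp (measurable_id.div_const 2)).div_const 2)
  have hhalf : ∀ s, 0 < s → φ (s / 2) / 2 ≤ φ s := by
    intro s hs
    have : φ (s / 2) / 2 = G (s / 2) / ENNReal.ofReal s := by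
      rw [hφ]
      dsimp only
      rw [ENNReal.ofReal_div_of_pos zero_lt_two, ENNReal.ofReal_ofNat, div_eq_mul_inv,
        div_eq_mul_inv, div_eq_mul_inv, div_eq_mul_inv,
        ENNReal.mul_inv (Or.inl (hofne hs)) (Or.inl ENNReal.ofReal_ne_top), inv_inv, mul_assoc,
        mul_assoc, ENNReal.mul_inv_cancel two_ne_zero ENNReal.ofNat_ne_top, mul_one]
      exact (div_eq_mul_inv _ _).symm
    rw [this]
    exact ENNReal.div_le_div_right (hG (by linarith)) _
  have hJle : ∀ {a b : ℝ}, a ∈ Ioo (0 : ℝ) 1 → b ≤ 1 →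
      ∫⁻ s in Ioo a b, φ s ≤ φ a * ENNReal.ofReal (b - a) := by
    intro a b ha hb
    rw [← Real.volume_Ioo, ← setLIntegral_const]
    exact setLIntegral_mono' measurableSet_Ioo fun s hs =>
      hanti ha ⟨ha.1.trans hs.1, hs.2.trans_le hb⟩ hs.1.le
  have hJG : ∀ {a : ℝ}, a ∈ Ioo (0 : ℝ) 1 → ∫⁻ s in Ioo (a / 2) a, φ s ≤ G a := by
    intro a ha
    refine (hJle ⟨half_pos ha.1, by linarith [ha.1, ha.2]⟩ ha.2.le).trans ?_
    rw [sub_half, hφG _ (half_pos ha.1)]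
    exact hG (by linarith [ha.1])
  -- The substitution `s ↦ 2 s` makes the integral of the difference quotient telescope.
  have hid : ∀ {a t : ℝ}, t ∈ Ioo (0 : ℝ) 1 → 0 < a → a < t / 2 →
      (∫⁻ s in Ioo (a / 2) a, φ s) + ∫⁻ s in Ioo a t, h s = ∫⁻ s in Ioo (t / 2) t, φ s := by
    intro a t ht ha hat
    have h1 : (∫⁻ s in Ioo (a / 2) (t / 2), φ s) + ∫⁻ s in Ioo a t, h s
        = ∫⁻ s in Ioo a t, φ s := by
      have h2 := setLIntegral_comp_div zero_lt_two (a / 2) (t / 2) φ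
      rw [mul_div_cancel₀ _ two_ne_zero, mul_div_cancel₀ _ two_ne_zero, ENNReal.ofReal_ofNat] at h2
      have h3 : ∫⁻ s in Ioo (a / 2) (t / 2), φ s = ∫⁻ s in Ioo a t, φ (s / 2) / 2 := by
        simp only [div_eq_mul_inv (φ _)]
        rw [lintegral_mul_const' _ _ (by simp), h2, mul_comm, ← mul_assoc,
          ENNReal.inv_mul_cancel two_ne_zero ENNReal.ofNat_ne_top, one_mul]
      rw [h3, ← lintegral_add_right _ hhm]
      exact setLIntegral_congr_fun measurableSet_Ioo fun s hs =>
        add_tsub_cancel_of_le (hhalf s (ha.trans hs.1))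
    have ha1 : a ∈ Ioo (0 : ℝ) 1 := ⟨ha, by linarith [ht.1, ht.2]⟩
    have hJfin : ∫⁻ s in Ioo a (t / 2), φ s ≠ ∞ :=
      ne_top_of_le_ne_top (ENNReal.mul_ne_top (hφfin a ha1) ENNReal.ofReal_ne_top)
        (hJle ha1 (by linarith [ht.1, ht.2]))
    rw [setLIntegral_Ioo_add φ (half_lt_self ha) hat.le,
      setLIntegral_Ioo_add φ hat (half_le_self ht.1.le), add_right_comm, add_comm] at h1
    exact (ENNReal.add_right_inj hJfin).1 h1
  have hupper : ∀ t ∈ Ioo (0 : ℝ) 1, ∫⁻ s in Ioo 0 t, h s ≤ G t := fun t ht =>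
    setLIntegral_Ioo_zero_le ht.1 fun a ha hat =>
      (le_add_self.trans_eq (hid ht ha hat)).trans (hJG ht)
  refine ⟨h, hhm, fun t ht => ⟨?_, ?_⟩⟩
  · have h1 : G t / 2 ≤ ∫⁻ s in Ioo (t / 2) t, φ s := by
      calc G t / 2 = φ t * ENNReal.ofReal (t - t / 2) := by
            rw [sub_half, ENNReal.ofReal_div_of_pos zero_lt_two, ENNReal.ofReal_ofNat,
              ← mul_div_assoc, hφG t ht.1]
        _ = ∫⁻ s in Ioo (t / 2) t, φ t := by rw [setLIntegral_const, Real.volume_Ioo]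
        _ ≤ _ := setLIntegral_mono' measurableSet_Ioo fun s hs =>
            hanti ⟨(half_pos ht.1).trans hs.1, hs.2.trans ht.2⟩ ht hs.2.le
    have h2 : Tendsto (fun a => G a + ∫⁻ s in Ioo 0 t, h s) (𝓝[>] 0)
        (𝓝 (0 + ∫⁻ s in Ioo 0 t, h s)) := h0.add tendsto_const_nhds
    have h3 : G t / 2 ≤ 0 + ∫⁻ s in Ioo 0 t, h s := by
      refine ge_of_tendsto h2 ?_
      filter_upwards [Ioo_mem_nhdsGT (half_pos ht.1)] with a ha
      refine (h1.trans_eq (hid ht ha.1 ha.2).symm).trans (add_le_add (hJG ⟨ha.1, ?_⟩) ?_)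
      · linarith [ha.2, ht.1, ht.2]
      · exact lintegral_mono_set (Ioo_subset_Ioo_left ha.1.le)
    rw [zero_add] at h3
    rw [mul_comm]
    exact (ENNReal.div_le_iff two_ne_zero ENNReal.ofNat_ne_top).1 h3
  -- The level `φ t` is chosen because `h ≤ φ ≤ φ t` to the right of `t`.
  · refine (setLIntegral_rearr_le hhm.aemeasurable ht.2.le (φ t)).trans ?_
    rw [hφG t ht.1, two_mul]
    gcongr
    refine le_trans ?_ (hupper t ht)
    rw [← lintegral_indicator measurableSet_Ioo, ← lintegral_indicator measurableSet_Ioo]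
    refine lintegral_mono fun s => ?_
    by_cases hs : s ∈ Ioo (0 : ℝ) 1
    · by_cases hst : s < t
      · simp [indicator, hs.1, hs.2, hst]
      · have : h s - φ t = 0 := tsub_eq_zero_of_le (tsub_le_self.trans (hanti ht hs (not_lt.1 hst)))
        simp [indicator, hs.1, hs.2, hst, this]
    · rw [indicator_of_notMem hs]; exact zero_le

theorem negTrunc_measure_Ioo_le (f : ℝ → ℝ≥0∞) (n : ℕ) (t : ℝ) :
    (negTrunc f n).measure (Ioo t 1) ≤ rearr f t := by
  have hne : min (rearr f t) (n : ℝ≥0∞) ≠ ∞ :=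
    ne_top_of_le_ne_top (ENNReal.natCast_ne_top n) (min_le_right _ _)
  rw [StieltjesFunction.measure_Ioo]
  have h1 : Function.leftLim (negTrunc f n) 1 ≤ 0 :=
    ((negTrunc f n).mono.leftLim_le le_rfl).trans (neg_nonpos.2 ENNReal.toReal_nonneg)
  calc _ ≤ ENNReal.ofReal (min (rearr f t) (n : ℝ≥0∞)).toReal := by
        refine ENNReal.ofReal_le_ofReal ?_
        change Function.leftLim (negTrunc f n) 1 - -(min (rearr f t) (n : ℝ≥0∞)).toReal ≤ _
        linarith
    _ = min (rearr f t) (n : ℝ≥0∞) := ENNReal.ofReal_toReal hne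
    _ ≤ _ := min_le_left _ _

theorem min_rearr_le_negTrunc_measure_Ioo_add {f : ℝ → ℝ≥0∞} (hf : MPlus f) (n : ℕ) {t : ℝ} :
    min (rearr f t) (n : ℝ≥0∞) ≤
      (negTrunc f n).measure (Ioo t 1) + ∫⁻ x in Ioo (0 : ℝ) 1, f x := by
  have hne : ∀ s, min (rearr f s) (n : ℝ≥0∞) ≠ ∞ := fun s =>
    ne_top_of_le_ne_top (ENNReal.natCast_ne_top n) (min_le_right _ _)
  rw [StieltjesFunction.measure_Ioo, ← lintegral_rearr hf]
  set b := Function.leftLim (negTrunc f n) 1 with hb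
  have h1 : ENNReal.ofReal (-b) ≤ ∫⁻ x in Ioo (0 : ℝ) 1, rearr f x := by
    calc ENNReal.ofReal (-b) = ∫⁻ x in Ioo (0 : ℝ) 1, ENNReal.ofReal (-b) := by simp
      _ ≤ _ := by
        refine setLIntegral_mono' measurableSet_Ioo fun s hs => ?_
        have h2 : -(min (rearr f s) (n : ℝ≥0∞)).toReal ≤ b :=
          (negTrunc f n).mono.le_leftLim hs.2
        calc ENNReal.ofReal (-b) ≤ ENNReal.ofReal (min (rearr f s) (n : ℝ≥0∞)).toReal :=
              ENNReal.ofReal_le_ofReal (by linarith)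
          _ = min (rearr f s) (n : ℝ≥0∞) := ENNReal.ofReal_toReal (hne s)
          _ ≤ _ := min_le_left _ _
  calc min (rearr f t) (n : ℝ≥0∞)
      = ENNReal.ofReal (b - -(min (rearr f t) (n : ℝ≥0∞)).toReal + -b) := by
        rw [← ENNReal.ofReal_toReal (hne t)]
        congr 1
        rw [ENNReal.ofReal_toReal (hne t)]
        ring
    _ ≤ ENNReal.ofReal (b - -(min (rearr f t) (n : ℝ≥0∞)).toReal) + ENNReal.ofReal (-b) :=
        ENNReal.ofReal_add_le
    _ ≤ _ := by
        gcongr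
        exact le_rfl

theorem IsQuasiconcave.le_div_mul {I : ℝ → ℝ} (hI : IsQuasiconcave I) {s t : ℝ}
    (hs : s ∈ Ioo (0 : ℝ) 1) (ht : t ∈ Ioo (0 : ℝ) 1) (hst : s ≤ t) : I t ≤ t / s * I s := by
  have h1 : I t / t ≤ I s / s := hI.antitoneOn hs ht hst
  rw [div_le_iff₀ ht.1] at h1
  calc I t ≤ I s / s * t := h1
    _ = t / s * I s := by ring

section Explicit

variable {I : ℝ → ℝ} {ρ : (ℝ → ℝ≥0∞) → ℝ≥0∞}

/-- The Stieltjes integrals of the truncated function `I min(g^*, n)` are dominated through a density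
for its quasiconcave majorant. -/
theorem lintegral_mul_min_negTrunc_le (hI : IsQuasiconcave I) {f g : ℝ → ℝ≥0∞}
    (h1 : assoc ρ (opS I g) ≤ 1) (m n : ℕ) :
    ∫⁻ t in Ioo (0 : ℝ) 1, ENNReal.ofReal (I t) * min (rearr g t) n ∂(negTrunc f m).measure
      ≤ 4 * optNorm I ρ f := by
  set G : ℝ → ℝ≥0∞ := fun t => ⨆ s ∈ Ioc 0 t, ENNReal.ofReal (I s) * min (rearr g s) n with hGdef
  have hle : ∀ {s t : ℝ}, 0 < s → s ≤ t → ENNReal.ofReal (I s) * min (rearr g s) n ≤ G t :=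
    fun hs hst => le_iSup₂_of_le (f := fun s _ => ENNReal.ofReal (I s) * min (rearr g s) n) _
      ⟨hs, hst⟩ le_rfl
  have hG : Monotone G := fun s t hst => iSup₂_le fun r hr => hle hr.1 (hr.2.trans hst)
  have hGI : ∀ t ∈ Ioo (0 : ℝ) 1, G t ≤ ENNReal.ofReal (I t) * n := fun t ht =>
    iSup₂_le fun s hs => mul_le_mul' (ENNReal.ofReal_le_ofReal
      (hI.monotoneOn ⟨hs.1, hs.2.trans_lt ht.2⟩ ht hs.2)) (min_le_right _ _)
  have hfin : ∀ t ∈ Ioo (0 : ℝ) 1, G t ≠ ∞ := fun t ht => ne_top_of_le_ne_top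
    (ENNReal.mul_ne_top ENNReal.ofReal_ne_top (ENNReal.natCast_ne_top n)) (hGI t ht)
  -- Without the truncation of `g` at height `n`, `G` may have a positive limit at `0`.
  have h0 : Tendsto G (𝓝[>] 0) (𝓝 0) := by
    have hlim : Tendsto (fun t => ENNReal.ofReal (I t) * n) (𝓝[>] 0) (𝓝 0) := by
      have := ENNReal.Tendsto.mul_const (ENNReal.tendsto_ofReal hI.tendsto_zero)
        (b := (n : ℝ≥0∞)) (Or.inr (ENNReal.natCast_ne_top n))
      simpa using this
    refine tendsto_of_tendsto_of_tendsto_of_le_of_le' tendsto_const_nhds hlim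
      (Eventually.of_forall fun _ => zero_le) ?_
    filter_upwards [Ioo_mem_nhdsGT zero_lt_one] with t ht using hGI t ht
  have hanti : AntitoneOn (fun t => G t / ENNReal.ofReal t) (Ioo 0 1) := by
    intro s hs t ht hst
    have hs0 : ENNReal.ofReal s ≠ 0 := by simpa using hs.1
    have ht0 : ENNReal.ofReal t ≠ 0 := by simpa using ht.1
    have key : G t ≤ ENNReal.ofReal (t / s) * G s := by
      refine iSup₂_le fun r hr => ?_
      rcases le_or_gt r s with h | h
      · refine (hle hr.1 h).trans (le_mul_of_one_le_left' ?_)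
        rwa [ENNReal.one_le_ofReal, one_le_div hs.1]
      · have hr1 : r ∈ Ioo (0 : ℝ) 1 := ⟨hr.1, hr.2.trans_lt ht.2⟩
        calc ENNReal.ofReal (I r) * min (rearr g r) n
            ≤ ENNReal.ofReal (t / s * I s) * min (rearr g s) n := by
              gcongr
              · refine (hI.le_div_mul hs hr1 h.le).trans ?_
                gcongr
                · exact (hI.pos hs).le
                · exact hs.1.le
                · exact hr.2
              · exact rearr_antitone g h.le
          _ = ENNReal.ofReal (t / s) * (ENNReal.ofReal (I s) * min (rearr g s) n) := by
              rw [ENNReal.ofReal_mul (div_nonneg ht.1.le hs.1.le), mul_assoc]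
          _ ≤ _ := by
              gcongr
              exact hle hs.1 le_rfl
    refine ENNReal.div_le_of_le_mul (key.trans_eq ?_)
    dsimp only
    rw [ENNReal.ofReal_div_of_pos hs.1, div_eq_mul_inv, div_eq_mul_inv]
    ring
  obtain ⟨h, hhm, hh⟩ := exists_density_of_quasiconcave hG hfin hanti h0
  have hN : assoc ρ (opR I h) ≤ (2 : ℝ≥0) := by
    have h2 : assoc ρ (opR I h) ≤ assoc ρ (fun t => 2 * opS I g t) := by
      refine assoc_mono ?_
      filter_upwards [ae_restrict_mem measurableSet_Ioo] with t ht
      rw [opR, opS, ← mul_div_assoc]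
      refine ENNReal.div_le_div_right ((hh t ht).2.trans ?_) _
      refine mul_le_mul_right (iSup₂_mono fun s _ => ?_) _
      gcongr
      exact min_le_left _ _
    refine h2.trans ?_
    rw [assoc_smul _ ENNReal.ofNat_ne_top]
    calc _ ≤ (2 : ℝ≥0∞) * 1 := by gcongr
      _ = _ := by simp
  have htri := lintegral_triangle (μ := volume) (ν := (negTrunc f m).measure) (a := fun _ => 1)
    (b := h) aemeasurable_const hhm.aemeasurable
  simp only [setLIntegral_const, one_mul] at htri
  calc _ ≤ ∫⁻ t in Ioo (0 : ℝ) 1, 2 * (∫⁻ s in Ioo 0 t, h s) ∂(negTrunc f m).measure := by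
        refine setLIntegral_mono' measurableSet_Ioo fun t ht => ?_
        exact (hle ht.1 le_rfl).trans (hh t ht).1
    _ = 2 * ∫⁻ t in Ioo (0 : ℝ) 1, (negTrunc f m).measure (Ioo t 1) * h t := by
        rw [lintegral_const_mul' _ _ ENNReal.ofNat_ne_top, htri]
    _ ≤ 2 * ∫⁻ t in Ioo (0 : ℝ) 1, rearr f t * h t := by
        gcongr with t
        exact negTrunc_measure_Ioo_le f m t
    _ ≤ 2 * ∫⁻ t in Ioo (0 : ℝ) 1, rearr f t * rearr h t := by
        refine mul_le_mul_right ((lintegral_mul_le_rearr (mplus_rearr f)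
          hhm.aemeasurable).trans_eq ?_) _
        rw [rearr_rearr]
    _ ≤ 2 * ((2 : ℝ≥0) * optNorm I ρ f) := by
        gcongr
        exact lintegral_le_optNorm f hhm.aemeasurable two_ne_zero hN
    _ = _ := by
        rw [← mul_assoc]
        congr 1
        norm_num

theorem exists_explicitNorm_le_optNorm (hI : IsQuasiconcave I) (hρ : IsRINorm ρ) :
    ∃ C : ℝ≥0, ∀ f, MPlus f → explicitNorm I ρ f ≤ C * optNorm I ρ f := by
  obtain ⟨C, hC⟩ := exists_lintegral_le_optNorm hI hρ
  refine ⟨4 + C, fun f hf => ?_⟩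
  rw [ENNReal.coe_add, add_mul]
  refine add_le_add (iSup₂_le fun g _ => iSup_le fun h1 => iSup_le fun m => ?_) (hC f hf)
  have hImeas : AEMeasurable (fun t => ENNReal.ofReal (I t))
      ((negTrunc f m).measure.restrict (Ioo 0 1)) :=
    aemeasurable_restrict_of_monotoneOn measurableSet_Ioo fun _ hs _ ht h =>
      ENNReal.ofReal_le_ofReal (hI.monotoneOn hs ht h)
  refine le_of_tendsto' (lintegral_tendsto_of_tendsto_of_monotone
      (f := fun (n : ℕ) t => ENNReal.ofReal (I t) * min (rearr g t) n) (fun n => ?_) ?_ ?_)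
      fun n => lintegral_mul_min_negTrunc_le hI h1 m n
  · exact hImeas.mul ((measurable_rearr g).min measurable_const).aemeasurable
  · refine Eventually.of_forall fun x m n hmn => ?_
    dsimp only
    gcongr
  · exact Eventually.of_forall fun x =>
      ENNReal.Tendsto.const_mul (tendsto_min_natCast _) (Or.inr ENNReal.ofReal_ne_top)

end Explicit

/-! ### The optimal norm is dominated by the explicit norm -/

/-- The least nonincreasing majorant of `R_I h` on `(0, 1)`. -/
noncomputable def supR (I : ℝ → ℝ) (h : ℝ → ℝ≥0∞) (t : ℝ) : ℝ≥0∞ :=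
  ⨆ r ∈ Ico t 1, opR I h r

section SupR

variable {I : ℝ → ℝ} {ρ : (ℝ → ℝ≥0∞) → ℝ≥0∞}

theorem antitone_supR (I : ℝ → ℝ) (h : ℝ → ℝ≥0∞) : Antitone (supR I h) := fun _ _ hst =>
  biSup_mono fun _ hr => ⟨hst.trans hr.1, hr.2⟩

theorem le_supR {h : ℝ → ℝ≥0∞} {s t : ℝ} (hst : t ≤ s) (hs : s < 1) :
    opR I h s ≤ supR I h t :=
  le_iSup₂_of_le (f := fun r _ => opR I h r) s ⟨hst, hs⟩ le_rfl

theorem mul_opR (hI : IsQuasiconcave I) (h : ℝ → ℝ≥0∞) {t : ℝ} (ht : t ∈ Ioo (0 : ℝ) 1) :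
    ENNReal.ofReal (I t) * opR I h t = ∫⁻ s in Ioo 0 t, rearr h s :=
  ENNReal.mul_div_cancel (by simpa using hI.pos ht) ENNReal.ofReal_ne_top

/-- Left of `t`, the factor `I(s) ≤ I(r)` turns `R_I h(r)` into the nondecreasing `∫₀ʳ h^*`. -/
theorem opS_supR_le (hI : IsQuasiconcave I) (h : ℝ → ℝ≥0∞) {t : ℝ} (ht : t ∈ Ioo (0 : ℝ) 1) :
    opS I (supR I h) t ≤ supR I h t := by
  refine ENNReal.div_le_of_le_mul (iSup₂_le fun s hs => ?_)
  have hs1 : s ∈ Ioo (0 : ℝ) 1 := ⟨hs.1, hs.2.trans_lt ht.2⟩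
  calc ENNReal.ofReal (I s) * rearr (supR I h) s
      ≤ ENNReal.ofReal (I s) * supR I h s := by
        gcongr
        exact rearr_le_of_antitoneOn ((antitone_supR I h).antitoneOn _) hs1
    _ ≤ supR I h t * ENNReal.ofReal (I t) := by
        simp only [supR, ENNReal.mul_iSup]
        refine iSup₂_le fun r hr => ?_
        have hr1 : r ∈ Ioo (0 : ℝ) 1 := ⟨hs.1.trans_le hr.1, hr.2⟩
        rcases le_total t r with htr | hrt
        · rw [mul_comm]
          exact mul_le_mul' (le_supR htr hr.2)
            (ENNReal.ofReal_le_ofReal (hI.monotoneOn hs1 ht hs.2))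
        · calc ENNReal.ofReal (I s) * opR I h r ≤ ENNReal.ofReal (I r) * opR I h r := by
                gcongr
                exact hI.monotoneOn hs1 hr1 hr.1
            _ = ∫⁻ s in Ioo 0 r, rearr h s := mul_opR hI h hr1
            _ ≤ ∫⁻ s in Ioo 0 t, rearr h s := lintegral_mono_set (Ioo_subset_Ioo_right hrt)
            _ = ENNReal.ofReal (I t) * opR I h t := (mul_opR hI h ht).symm
            _ ≤ _ := by
                rw [mul_comm]
                exact mul_le_mul_left (le_supR le_rfl ht.2) _

/-- The inequality holds at every `t`, not only almost everywhere, as is needed for integration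
against Stieltjes measures with atoms. -/
theorem opR_le_two_mul_rearr_supR (hI : IsQuasiconcave I) (h : ℝ → ℝ≥0∞) {t : ℝ}
    (ht : t ∈ Ioo (0 : ℝ) 1) : opR I h t ≤ 2 * rearr (supR I h) t := by
  obtain ⟨s, hts, hs⟩ := exists_between (lt_min (by linarith [ht.1] : t < 2 * t) ht.2)
  have hs1 : s ∈ Ioo (0 : ℝ) 1 := ⟨ht.1.trans hts, hs.trans_le (min_le_right _ _)⟩
  have hs2 : s ≤ 2 * t := hs.le.trans (min_le_left _ _)
  have hIs : I s ≤ 2 * I t := by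
    refine (hI.le_div_mul ht hs1 hts.le).trans ?_
    gcongr
    · exact (hI.pos ht).le
    · rwa [div_le_iff₀ ht.1]
  have h1 : opR I h t ≤ 2 * opR I h s := by
    refine ENNReal.div_le_of_le_mul ?_
    calc ∫⁻ x in Ioo 0 t, rearr h x ≤ ∫⁻ x in Ioo 0 s, rearr h x :=
          lintegral_mono_set (Ioo_subset_Ioo_right hts.le)
      _ = ENNReal.ofReal (I s) * opR I h s := (mul_opR hI h hs1).symm
      _ ≤ ENNReal.ofReal (2 * I t) * opR I h s := by gcongr
      _ = _ := by
          rw [ENNReal.ofReal_mul zero_le_two, ENNReal.ofReal_ofNat]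
          ring
  refine h1.trans (mul_le_mul_right ((le_supR le_rfl hs1.2).trans ?_) _)
  exact le_rearr_of_antitoneOn ((antitone_supR I h).antitoneOn _) ht.1.le hts hs1.2

/-- A value of `R_I h` at `r` is attained, up to the factor `2`, on all of `(r/2, r)`. -/
theorem supR_le_two_mul_rearr_opR (hI : IsQuasiconcave I) (h : ℝ → ℝ≥0∞) {t : ℝ}
    (ht : t ∈ Ioo (0 : ℝ) 1) : supR I h t ≤ 2 * rearr (opR I h) (t / 4) := by
  refine iSup₂_le fun r hr => ?_
  have hr1 : r ∈ Ioo (0 : ℝ) 1 := ⟨ht.1.trans_le hr.1, hr.2⟩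
  have hhalf : ∫⁻ s in Ioo 0 r, rearr h s ≤ 2 * ∫⁻ s in Ioo 0 (r / 2), rearr h s := by
    have h2 := setLIntegral_comp_div zero_lt_two 0 (r / 2) (rearr h)
    rw [mul_zero, mul_div_cancel₀ _ two_ne_zero, ENNReal.ofReal_ofNat] at h2
    rw [← h2]
    exact setLIntegral_mono' measurableSet_Ioo fun t ht =>
      rearr_antitone h (div_le_self ht.1.le one_le_two)
  rw [mul_comm, ← ENNReal.div_le_iff two_ne_zero ENNReal.ofNat_ne_top]
  refine le_of_forall_lt fun l hl => ?_
  rw [lt_rearr_iff]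
  refine lt_measure_of_subset (c := r / 2) (s := r / 2) (by linarith [ht.1])
    (by linarith [ht.1, hr.1]) fun x hx => ?_
  rw [add_halves] at hx
  have hx1 : x ∈ Ioo (0 : ℝ) 1 := ⟨(half_pos hr1.1).trans hx.1, hx.2.trans hr1.2⟩
  refine ⟨hl.trans_le ?_, hx1⟩
  rw [ENNReal.div_le_iff two_ne_zero ENNReal.ofNat_ne_top]
  refine ENNReal.div_le_of_le_mul ?_
  calc _ ≤ 2 * ∫⁻ s in Ioo 0 x, rearr h s :=
        hhalf.trans (mul_le_mul_right (lintegral_mono_set (Ioo_subset_Ioo_right hx.1.le)) _)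
    _ = 2 * (ENNReal.ofReal (I x) * opR I h x) := by rw [mul_opR hI h hx1]
    _ ≤ 2 * (ENNReal.ofReal (I r) * opR I h x) := by
        gcongr
        exact hI.monotoneOn hx1 hr1 hx.2.le
    _ = _ := by ring

theorem assoc_opS_supR_le (hI : IsQuasiconcave I) (hρ : IsRINorm ρ) (h : ℝ → ℝ≥0∞) :
    assoc ρ (opS I (supR I h)) ≤ 8 * assoc ρ (opR I h) := by
  have hmem := ae_restrict_mem (μ := volume) (measurableSet_Ioo (a := (0 : ℝ)) (b := 1))
  calc assoc ρ (opS I (supR I h)) ≤ assoc ρ (fun t => 2 * rearr (opR I h) (t / 4)) := by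
        refine assoc_mono ?_
        filter_upwards [hmem] with t ht
        exact (opS_supR_le hI h ht).trans (supR_le_two_mul_rearr_opR hI h ht)
    _ = 2 * assoc ρ (fun t => rearr (opR I h) (t / 4)) := assoc_smul _ ENNReal.ofNat_ne_top
    _ ≤ 2 * (ENNReal.ofReal 4 * assoc ρ (rearr (opR I h))) := by
        gcongr
        exact assoc_dilation_le hρ _ (by norm_num)
    _ ≤ 2 * (ENNReal.ofReal 4 * assoc ρ (opR I h)) := by
        gcongr
        exact assoc_rearr_le hρ (mplus_opR hI h)
    _ = _ := by
        rw [← mul_assoc, ENNReal.ofReal_ofNat]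
        norm_num

theorem stieltjesInt_supR_le (f : ℝ → ℝ≥0∞) {h : ℝ → ℝ≥0∞}
    (h8 : assoc ρ (opS I (supR I h)) ≤ 8) :
    stieltjesInt (fun t => ENNReal.ofReal (I t) * rearr (supR I h) t) f
      ≤ 8 * explicitNorm I ρ f := by
  set u : ℝ → ℝ≥0∞ := fun t => (8⁻¹ : ℝ≥0) * supR I h t with hu
  have h88 : (8 : ℝ≥0∞) * (8⁻¹ : ℝ≥0) = 1 := by
    rw [ENNReal.coe_inv (by norm_num)]
    exact ENNReal.mul_inv_cancel (by norm_num) ENNReal.ofNat_ne_top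
  have hru : ∀ t, rearr u t = (8⁻¹ : ℝ≥0) * rearr (supR I h) t := fun t =>
    rearr_smul (supR I h) (by norm_num) t
  have hS : opS I u = fun t => (8⁻¹ : ℝ≥0) * opS I (supR I h) t := by
    ext t
    simp only [opS, hru, ← mul_div_assoc, ENNReal.mul_iSup, mul_left_comm]
  have h1 : assoc ρ (opS I u) ≤ 1 := by
    rw [hS, assoc_smul _ ENNReal.coe_ne_top]
    calc _ ≤ ((8⁻¹ : ℝ≥0) : ℝ≥0∞) * 8 := by gcongr
      _ = 1 := by rw [mul_comm, h88]
  have hum : MPlus u := (antitone_supR I h).measurable.aemeasurable.const_mul _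
  have h2 : stieltjesInt (fun t => ENNReal.ofReal (I t) * rearr (supR I h) t) f
      = 8 * stieltjesInt (fun t => ENNReal.ofReal (I t) * rearr u t) f := by
    simp only [stieltjesInt, ENNReal.mul_iSup, ← lintegral_const_mul' _ _ ENNReal.ofNat_ne_top, hru]
    refine iSup_congr fun n => lintegral_congr fun t => ?_
    rw [mul_left_comm (ENNReal.ofReal _), ← mul_assoc, h88, one_mul]
  rw [h2]
  refine mul_le_mul_right (le_add_right ?_) _
  exact le_iSup₂_of_le (f := fun g (_ : MPlus g) => ⨆ _ : assoc ρ (opS I g) ≤ 1,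
    stieltjesInt (fun t => ENNReal.ofReal (I t) * rearr g t) f) u hum (le_iSup_of_le h1 le_rfl)

theorem exists_optNorm_le_explicitNorm (hI : IsQuasiconcave I) (hρ : IsRINorm ρ) :
    ∃ C : ℝ≥0, ∀ f, MPlus f → optNorm I ρ f ≤ C * explicitNorm I ρ f := by
  obtain ⟨C, hC⟩ := exists_lintegral_rearr_le hI hρ
  refine ⟨16 + C, fun f hf => optNorm_le_iff.2 fun h hh h1 => ?_⟩
  have hint : ∫⁻ t in Ioo (0 : ℝ) 1, rearr h t ≤ C := calc
    _ ≤ C * assoc ρ (opR I h) := hC h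
    _ ≤ C * 1 := by gcongr
    _ = C := mul_one _
  have h8 : assoc ρ (opS I (supR I h)) ≤ 8 := calc
    _ ≤ 8 * assoc ρ (opR I h) := assoc_opS_supR_le hI hρ h
    _ ≤ 8 * 1 := by gcongr
    _ = 8 := mul_one _
  have hn : ∀ n : ℕ, ∫⁻ t in Ioo (0 : ℝ) 1, min (rearr f t) n * rearr h t
      ≤ (16 + C : ℝ≥0) * explicitNorm I ρ f := by
    intro n
    have htri := lintegral_triangle (μ := volume) (ν := (negTrunc f n).measure) (a := fun _ => 1)
      (b := rearr h) aemeasurable_const (mplus_rearr h)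
    simp only [setLIntegral_const, one_mul] at htri
    calc ∫⁻ t in Ioo (0 : ℝ) 1, min (rearr f t) n * rearr h t
        ≤ ∫⁻ t in Ioo (0 : ℝ) 1, ((negTrunc f n).measure (Ioo t 1) * rearr h t
            + (∫⁻ x in Ioo (0 : ℝ) 1, f x) * rearr h t) := by
          refine lintegral_mono fun t => ?_
          dsimp only
          rw [← add_mul]
          gcongr
          exact min_rearr_le_negTrunc_measure_Ioo_add hf n
      _ = (∫⁻ t in Ioo (0 : ℝ) 1, (∫⁻ s in Ioo 0 t, rearr h s) ∂(negTrunc f n).measure)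
            + (∫⁻ x in Ioo (0 : ℝ) 1, f x) * ∫⁻ t in Ioo (0 : ℝ) 1, rearr h t := by
          rw [lintegral_add_right _ ((measurable_rearr h).const_mul _), htri,
            lintegral_const_mul _ (measurable_rearr h)]
      _ ≤ 2 * stieltjesInt (fun t => ENNReal.ofReal (I t) * rearr (supR I h) t) f
            + explicitNorm I ρ f * C := by
          gcongr
          · rw [stieltjesInt, ENNReal.mul_iSup]
            refine le_iSup_of_le n ?_
            rw [← lintegral_const_mul' _ _ ENNReal.ofNat_ne_top]
            refine setLIntegral_mono' measurableSet_Ioo fun t ht => ?_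
            rw [← mul_opR hI h ht, mul_left_comm]
            gcongr
            exact opR_le_two_mul_rearr_supR hI h ht
          · exact le_add_self
      _ ≤ 2 * (8 * explicitNorm I ρ f) + explicitNorm I ρ f * C := by
          gcongr
          exact stieltjesInt_supR_le f h8
      _ = _ := by
          push_cast
          ring
  refine le_of_tendsto' (lintegral_tendsto_of_tendsto_of_monotone
    (f := fun (n : ℕ) t => min (rearr f t) n * rearr h t) (fun n => ?_) ?_ ?_) hn
  · exact (((measurable_rearr f).min measurable_const).mul (measurable_rearr h)).aemeasurable
  · refine Eventually.of_forall fun x m n hmn => ?_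
    dsimp only
    gcongr
  · refine Eventually.of_forall fun t => ?_
    rcases eq_or_ne (rearr f t) 0 with h0 | h0
    -- If `rearr h t = ∞`, multiplication by it is discontinuous at `0` only.
    · simp [h0]
    · exact ENNReal.Tendsto.mul_const (tendsto_min_natCast _) (Or.inl h0)

end SupR

theorem Bounded.exists_pos_le {σ τ : (ℝ → ℝ≥0∞) → ℝ≥0∞} (h : Bounded (fun f => f) σ τ) :
    ∃ C : ℝ≥0, 0 < C ∧ ∀ f, MPlus f → τ f ≤ C * σ f := by
  obtain ⟨C, hC⟩ := h
  refine ⟨C + 1, by positivity, fun f hf => ?_⟩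
  rcases eq_or_ne (σ f) ∞ with hf1 | hf1
  · rw [hf1, ENNReal.mul_top (by positivity)]
    exact le_top
  · refine (hC f hf (lt_top_iff_ne_top.2 hf1)).trans ?_
    gcongr
    exact le_add_of_nonneg_right zero_le

end RISpace

theorem theorem1p1 (I : ℝ → ℝ) (hI : RISpace.IsQuasiconcave I)
    (hcond : ∃ C : ℝ≥0, ∀ t ∈ Ioo (0 : ℝ) 1,
      ∫⁻ s in Ioo 0 t, ENNReal.ofReal (I s / s) ≤ C * ENNReal.ofReal (I t))
    (ρ : (ℝ → ℝ≥0∞) → ℝ≥0∞) (hρ : RISpace.IsRINorm ρ) :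
    (∃ σ : (ℝ → ℝ≥0∞) → ℝ≥0∞, RISpace.IsOptimalTarget (RISpace.opH I) ρ σ) ∧
    ∀ σ : (ℝ → ℝ≥0∞) → ℝ≥0∞, RISpace.IsOptimalTarget (RISpace.opH I) ρ σ →
      ∃ C : ℝ≥0, 0 < C ∧ ∀ f : ℝ → ℝ≥0∞, RISpace.MPlus f →
        σ f ≤ C * RISpace.explicitNorm I ρ f ∧ RISpace.explicitNorm I ρ f ≤ C * σ f := by
  have hopt := RISpace.isOptimalTarget_optNorm hI hρ
  refine ⟨⟨_, hopt⟩, fun σ hσ => ?_⟩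
  obtain ⟨A, hA, hσA⟩ := (hopt.optimal σ hσ.isRINorm hσ.bounded).exists_pos_le
  obtain ⟨B, hB, hσB⟩ := (hσ.optimal _ hopt.isRINorm hopt.bounded).exists_pos_le
  obtain ⟨D, hD⟩ := RISpace.exists_optNorm_le_explicitNorm hI hρ
  obtain ⟨E, hE⟩ := RISpace.exists_explicitNorm_le_optNorm hI hρ
  refine ⟨A * D + E * B + 1, by positivity, fun f hf => ⟨?_, ?_⟩⟩
  · calc σ f ≤ A * (D * RISpace.explicitNorm I ρ f) := (hσA f hf).trans (by gcongr; exact hD f hf)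
      _ = (A * D : ℝ≥0) * RISpace.explicitNorm I ρ f := by rw [ENNReal.coe_mul, mul_assoc]
      _ ≤ _ := by
        gcongr
        rw [add_assoc]
        exact le_self_add
  · calc RISpace.explicitNorm I ρ f ≤ E * (B * σ f) := (hE f hf).trans (by gcongr; exact hσB f hf)
      _ = (E * B : ℝ≥0) * σ f := by rw [ENNReal.coe_mul, mul_assoc]
      _ ≤ _ := by
        gcongr
        rw [add_right_comm]
        exact le_add_self
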